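/- For $n\in\mathbb N=\{1,2,\dots\}$, $b\in\mathbb C$ and $c\in\mathbb N_0$ let $$L_n^*(x;b,c):=(x\partial_x+b)^c(x-1)^n=\sum_{j=0}^n(-1)^{n-j}\binom nj (j+b)^c x^j$$ be the multiplicative Laguerre polynomials. For a polynomial $P\in\mathbb C[x]$ of degree $n\ge 1$ let $[\![P]\!]_n:=\frac1n\sum_{z:P(z)=0}\delta_z$ (zeros counted with multiplicity) be its zero distribution, a probability measure on $\mathbb C$. For a compactly supported probability measure $\mu$ on $\mathbb C$ with moments $m_k=\int x^k\,\mu(dx)$ and $m_1\neq 0$, put $\psi_\mu(t)=\sum_{k\ge1}m_kt^k$; the $S$-transform of $\mu$ is the function $S_\mu$, analytic near $0$, determined by $S_\mu(\psi_\mu(t))=\frac{1+\psi_\mu(t)}{\psi_\mu(t)}\,t$ for all sufficiently small $t\ne0$. **Theorem (Asymptotic zero distribution of multiplicative Laguerre polynomials).** Let $(b_n)_{n\in\mathbb N}\subseteq\mathbb C$ and $(c_n)_{n\in\mathbb N}\subseteq\mathbb N_0$ be sequences such that $b_n/n\to\beta$ and $c_n/n\to\gamma$ as $n\to\infty$, where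 $\beta\in\mathbb C$ and $\gamma>0$ are constants. (a) The positive case: if $b_n\in\mathbb R\setminus[-n,0]$ for every $n\in\mathbb N$ and $\beta\in\mathbb R\setminus[-1,0]$, then the probability measures $[\![L_n^*(\cdot;b_n,c_n)]\!]_n$ converge weakly to some probability measure $\nu_{\beta,\gamma}$ on $[0,\infty)$. (b) The unitary case: if $\operatorname{Re}b_n=-n/2$ for every $n\in\mathbb N$ (and hence $\operatorname{Re}\beta=-1/2$), then the probability measures $[\![L_n^*(\cdot;b_n,c_n)]\!]_n$ converge weakly to some probability measure $\nu_{\beta,\gamma}$ on the unit circle. (c) In both cases $\nu_{\beta,\gamma}$ depends only on $\beta$ and $\gamma$, it is compactly supported with nonzero first moment, and its $S$-transform is $S(y)=\exp\left(\frac{\gamma}{\beta+1+y}\right)$ for $y$ near $0$ (so that $\nu_{\beta,\gamma}$ is a free multiplicative Poisson law). -/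

import Mathlib

open Filter Topology MeasureTheory Polynomial

noncomputable section

/-- The multiplicative Laguerre polynomial `L_n^*(x; b, c) = (x ∂_x + b)^c (x - 1)^n`. -/
def multiplicativeLaguerre (n : ℕ) (b : ℂ) (c : ℕ) : ℂ[X] :=
  (fun P : ℂ[X] => X * derivative P + C b * P)^[c] ((X - 1) ^ n)

/-- The measure `(1 / deg P) ∑ δ_z`, the sum running over the complex zeros `z` of `P`
counted with multiplicity. -/
def zeroCountingMeasure (P : ℂ[X]) : Measure ℂ :=
  (P.natDegree : ENNReal)⁻¹ • (P.roots.map (fun z => Measure.dirac z)).sum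

theorem zeroCountingMeasure_isProbabilityMeasure (P : ℂ[X]) (hP : P.natDegree ≠ 0) :
    IsProbabilityMeasure (zeroCountingMeasure P) := by
  have key : ∀ s : Multiset ℂ,
      ((s.map (fun z => Measure.dirac z)).sum : Measure ℂ) Set.univ = (s.card : ENNReal) := by
    intro s
    induction s using Multiset.induction_on with
    | empty => simp
    | cons a s ih => simp [ih, add_comm]
  have hc : P.roots.card = P.natDegree := (IsAlgClosed.splits P).natDegree_eq_card_roots.symm
  refine ⟨?_⟩
  rw [zeroCountingMeasure, Measure.smul_apply, key, hc, smul_eq_mul]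
  exact ENNReal.inv_mul_cancel (by exact_mod_cast hP) (ENNReal.natCast_ne_top _)

open Classical in
/-- The zero distribution of a complex polynomial of degree at least one, as a probability
measure on `ℂ`. (Constant polynomials, which have no zero distribution, get the value `δ_0`.) -/
def zeroDistribution (P : ℂ[X]) : ProbabilityMeasure ℂ :=
  if hP : P.natDegree ≠ 0 then
    ⟨zeroCountingMeasure P, zeroCountingMeasure_isProbabilityMeasure P hP⟩
  else ⟨Measure.dirac 0, inferInstance⟩

/-- The `k`-th analytic moment `m_k = ∫ x^k μ(dx)`. -/
def analyticMoment (μ : Measure ℂ) (k : ℕ) : ℂ := ∫ x, x ^ k ∂μ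

/-- The moment series `M_μ(t) = ∑_{k ≥ 0} m_k t^k`; for compactly supported `μ` it converges for
small `|t|`. -/
def momentSeries (μ : Measure ℂ) (t : ℂ) : ℂ := ∑' k : ℕ, analyticMoment μ k * t ^ k

/-- The transform `ψ_μ(t) = M_μ(t) - 1`. -/
def psiTransform (μ : Measure ℂ) (t : ℂ) : ℂ := momentSeries μ t - 1

/-- `μ` is compactly supported with nonzero first moment, and `S` is its S-transform: `S` is
analytic at `0` and `S(ψ_μ(t)) = (1 + ψ_μ(t)) / ψ_μ(t) * t` for all small `t ≠ 0`. As `m_1 ≠ 0`,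
`ψ_μ` is locally invertible at `0`, so this determines `S` in a neighbourhood of `0`. -/
def HasSTransform (μ : Measure ℂ) (S : ℂ → ℂ) : Prop :=
  (∃ K : Set ℂ, IsCompact K ∧ μ Kᶜ = 0) ∧
  analyticMoment μ 1 ≠ 0 ∧
  AnalyticAt ℂ S 0 ∧
  ∀ᶠ t in 𝓝[≠] (0 : ℂ),
    S (psiTransform μ t) = (1 + psiTransform μ t) / psiTransform μ t * t

end

/-! Fix `n` and let `Q_j` be the reversal of `L_n^*(·; b, j)`. Since `x∂_x` turns into `n - t∂_t`,
one has `Q_{j+1} = (n + b) Q_j - t Q_j'`. The series `ψ_j = -(1/n) t Q_j'/Q_j` is the moment series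
(without constant term) of the zero distribution. With `a = b/n + 1` the recursion reads `Q_{j+1} =
n (a + ψ_j) Q_j`, and logarithmic differentiation gives `ψ_{j+1} = ψ_j - (1/n) t ψ_j'/(a + ψ_j)`.
This is an Euler scheme of step `1/n` for the nonlinear equation `∂_s ψ = -t ψ'/(a + ψ)`, run up to
time `c_n/n → γ`.

The equation becomes linear for the compositional inverse `χ` of `ψ`: `∂_s χ = χ/(a + y)`, so from
`ψ = t/(1-t)` one gets `χ = y/(1+y) · exp(s/(a + y))`. The discrete analogue `y/(1+y) · (1 +
1/(n(a+y)))^j` is `schemeInverse`. The central estimate `IsMomentScheme.comp_sub_X` shows, by a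
discrete Grönwall argument on each coefficient, that `ψ_j ∘ schemeInverse = y + O(1/n)` uniformly in
`j ≤ c_n`. At `j = c_n` the discrete inverses converge to `y/(1+y) · exp(γ/(β+1+y))`, hence every
moment converges to the corresponding coefficient of `1 + ψ`, where `ψ` is the local inverse of this
function. The relation `χ(ψ(t)) = t` is the S-transform identity.

Weak convergence needs the location of the zeros. The operator `P ↦ xP' + bP` creates no zeros off
the unit circle (unitary case) or off the positive half-line (positive case). On these sets absolute
and mixed moments reduce to analytic ones (`IsMomentRigid`), so convergent moments give tightness,
their exponential growth gives compact support of all cluster points, and Stone–Weierstrass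
identifies the cluster points with each other (`IsMomentRigid.exists_tendsto`). -/

open Asymptotics

/-! ### Composition and Euler derivative of formal power series -/

/-- The Euler derivative `X d/dX` of a formal power series. -/
noncomputable def eulerDeriv (f : PowerSeries ℂ) : PowerSeries ℂ :=
  PowerSeries.X * PowerSeries.derivative ℂ f

theorem coeff_eulerDeriv (f : PowerSeries ℂ) (k : ℕ) :
    PowerSeries.coeff k (eulerDeriv f) = k * PowerSeries.coeff k f := by
  cases k with
  | zero => simp [eulerDeriv]
  | succ k =>
    rw [eulerDeriv, PowerSeries.coeff_succ_X_mul, PowerSeries.coeff_derivative]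
    push_cast; ring

theorem eulerDeriv_mul (f g : PowerSeries ℂ) :
    eulerDeriv (f * g) = eulerDeriv f * g + f * eulerDeriv g := by
  simp only [eulerDeriv, Derivation.leibniz, smul_eq_mul]
  ring

theorem eulerDeriv_add (f g : PowerSeries ℂ) :
    eulerDeriv (f + g) = eulerDeriv f + eulerDeriv g := by
  simp only [eulerDeriv, map_add, mul_add]

theorem eulerDeriv_sub (f g : PowerSeries ℂ) :
    eulerDeriv (f - g) = eulerDeriv f - eulerDeriv g := by
  simp only [eulerDeriv, map_sub, mul_sub]

theorem eulerDeriv_C (a : ℂ) : eulerDeriv (PowerSeries.C a) = 0 := by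
  simp [eulerDeriv]

/-- Composition of formal power series; meaningful when `g` has no constant term. -/
noncomputable def seriesComp (f g : PowerSeries ℂ) : PowerSeries ℂ := PowerSeries.subst g f

section seriesComp

variable {g : PowerSeries ℂ} (hg : PowerSeries.constantCoeff g = 0)
include hg

theorem hasSubst_of_constantCoeff : PowerSeries.HasSubst g :=
  PowerSeries.HasSubst.of_constantCoeff_zero' hg

theorem seriesComp_add (f₁ f₂ : PowerSeries ℂ) :
    seriesComp (f₁ + f₂) g = seriesComp f₁ g + seriesComp f₂ g :=
  PowerSeries.subst_add (hasSubst_of_constantCoeff hg) f₁ f₂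

theorem seriesComp_sub (f₁ f₂ : PowerSeries ℂ) :
    seriesComp (f₁ - f₂) g = seriesComp f₁ g - seriesComp f₂ g :=
  PowerSeries.subst_sub (hasSubst_of_constantCoeff hg) f₁ f₂

theorem seriesComp_mul (f₁ f₂ : PowerSeries ℂ) :
    seriesComp (f₁ * f₂) g = seriesComp f₁ g * seriesComp f₂ g :=
  PowerSeries.subst_mul (hasSubst_of_constantCoeff hg) f₁ f₂

theorem seriesComp_X : seriesComp PowerSeries.X g = g :=
  PowerSeries.subst_X (hasSubst_of_constantCoeff hg)

theorem seriesComp_C (a : ℂ) : seriesComp (PowerSeries.C a) g = PowerSeries.C a := by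
  have h := PowerSeries.subst_coe (hasSubst_of_constantCoeff hg) (Polynomial.C a)
  rw [Polynomial.coe_C, Polynomial.aeval_C] at h
  exact h

theorem seriesComp_one : seriesComp 1 g = 1 := by
  simpa using seriesComp_C hg 1

theorem seriesComp_inv {f : PowerSeries ℂ} (hf : PowerSeries.constantCoeff f ≠ 0) :
    seriesComp f⁻¹ g * seriesComp f g = 1 := by
  rw [← seriesComp_mul hg, PowerSeries.inv_mul_cancel _ hf, seriesComp_one hg]

omit hg in
theorem coeff_mul_pow_eq_zero (hg : PowerSeries.constantCoeff g = 0) (p : PowerSeries ℂ)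
    {N k : ℕ} (h : N < k) : PowerSeries.coeff N (g ^ k * p) = 0 := by
  have h1 : PowerSeries.X ^ k ∣ g ^ k * p :=
    Dvd.dvd.mul_right (pow_dvd_pow_of_dvd (PowerSeries.X_dvd_iff.2 hg) k) p
  exact PowerSeries.X_pow_dvd_iff.1 h1 N h

omit hg in
theorem coeff_pow_eq_zero (hg : PowerSeries.constantCoeff g = 0)
    {N k : ℕ} (h : N < k) : PowerSeries.coeff N (g ^ k) = 0 := by
  simpa using coeff_mul_pow_eq_zero hg 1 h

/-- `g ^ k` has order at least `k`, so only finitely many terms contribute. The free cutoff `M` lets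
coefficients of different orders share one range of summation. -/
theorem coeff_seriesComp_of_le (f : PowerSeries ℂ) {N M : ℕ} (h : N ≤ M) :
    PowerSeries.coeff N (seriesComp f g) =
      ∑ k ∈ Finset.range (M + 1), PowerSeries.coeff k f * PowerSeries.coeff N (g ^ k) := by
  rw [seriesComp, PowerSeries.coeff_subst' (hasSubst_of_constantCoeff hg)]
  rw [finsum_eq_sum_of_support_subset]
  · rfl
  · intro k hk
    by_contra hk'
    apply hk
    have : N < k := by
      simp only [Finset.coe_range, Set.mem_Iio, not_lt] at hk'
      omega
    simp only [smul_eq_mul]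
    rw [coeff_pow_eq_zero hg this, mul_zero]

theorem coeff_seriesComp (f : PowerSeries ℂ) (N : ℕ) :
    PowerSeries.coeff N (seriesComp f g) =
      ∑ k ∈ Finset.range (N + 1), PowerSeries.coeff k f * PowerSeries.coeff N (g ^ k) :=
  coeff_seriesComp_of_le hg f le_rfl

theorem coeff_seriesComp_mul (f p : PowerSeries ℂ) (N : ℕ) :
    PowerSeries.coeff N (seriesComp f g * p) =
      ∑ k ∈ Finset.range (N + 1), PowerSeries.coeff k f * PowerSeries.coeff N (g ^ k * p) := by
  rw [PowerSeries.coeff_mul]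
  have : ∀ q ∈ Finset.HasAntidiagonal.antidiagonal N, PowerSeries.coeff q.1 (seriesComp f g) *
      PowerSeries.coeff q.2 p = ∑ k ∈ Finset.range (N + 1), PowerSeries.coeff k f *
        (PowerSeries.coeff q.1 (g ^ k) * PowerSeries.coeff q.2 p) := by
    intro q hq
    have hq' : q.1 ≤ N := by
      have := Finset.HasAntidiagonal.mem_antidiagonal.1 hq
      omega
    rw [coeff_seriesComp_of_le hg f hq', Finset.sum_mul]
    exact Finset.sum_congr rfl fun k _ => by ring
  rw [Finset.sum_congr rfl this, Finset.sum_comm]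
  refine Finset.sum_congr rfl fun k _ => ?_
  rw [PowerSeries.coeff_mul, Finset.mul_sum]

theorem constantCoeff_seriesComp (f : PowerSeries ℂ) :
    PowerSeries.constantCoeff (seriesComp f g) = PowerSeries.constantCoeff f := by
  rw [← PowerSeries.coeff_zero_eq_constantCoeff_apply, coeff_seriesComp hg]
  simp

end seriesComp

/-! ### Families of power series with coefficients of a given order -/

/-- All coefficients of the power series `f i` are `O(ε i)` along the filter `l`. -/
def CoeffBigO {ι : Type*} (l : Filter ι) (ε : ι → ℝ) (f : ι → PowerSeries ℂ) : Prop :=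
  ∀ k, (fun i => PowerSeries.coeff k (f i)) =O[l] ε

namespace CoeffBigO

variable {ι : Type*} {l : Filter ι} {ε δ : ι → ℝ} {f g : ι → PowerSeries ℂ}

theorem add (hf : CoeffBigO l ε f) (hg : CoeffBigO l ε g) :
    CoeffBigO l ε (fun i => f i + g i) := fun k => by
  simpa using (hf k).add (hg k)

theorem sub (hf : CoeffBigO l ε f) (hg : CoeffBigO l ε g) :
    CoeffBigO l ε (fun i => f i - g i) := fun k => by
  simpa using (hf k).sub (hg k)

theorem mul (hf : CoeffBigO l ε f) (hg : CoeffBigO l δ g) :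
    CoeffBigO l (fun i => ε i * δ i) (fun i => f i * g i) := fun k => by
  simp only [PowerSeries.coeff_mul]
  exact IsBigO.fun_sum fun p _ => (hf p.1).mul (hg p.2)

theorem mul_one (hf : CoeffBigO l ε f) (hg : CoeffBigO l (fun _ => 1) g) :
    CoeffBigO l ε (fun i => f i * g i) := by
  simpa using hf.mul hg

theorem one_mul (hf : CoeffBigO l (fun _ => 1) f) (hg : CoeffBigO l ε g) :
    CoeffBigO l ε (fun i => f i * g i) := by
  simpa using hf.mul hg

theorem const (p : PowerSeries ℂ) : CoeffBigO l (fun _ => 1) (fun _ => p) :=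
  fun _ => isBigO_const_const _ one_ne_zero _

theorem C {a : ι → ℂ} (ha : a =O[l] ε) : CoeffBigO l ε (fun i => PowerSeries.C (a i)) := by
  intro k
  cases k with
  | zero => simpa using ha
  | succ k => simpa [PowerSeries.coeff_C] using isBigO_zero _ _

theorem pow (hf : CoeffBigO l (fun _ => 1) f) (n : ℕ) :
    CoeffBigO l (fun _ => 1) (fun i => f i ^ n) := by
  induction n with
  | zero => simpa using const (l := l) 1
  | succ n ih => simpa [pow_succ] using ih.mul_one hf

theorem trans (hf : CoeffBigO l ε f) (h : ε =O[l] δ) : CoeffBigO l δ f :=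
  fun k => (hf k).trans h

theorem congr (hf : CoeffBigO l ε f) (h : f =ᶠ[l] g) : CoeffBigO l ε g := fun k =>
  (hf k).congr' (h.mono fun i hi => by simp only [hi]) EventuallyEq.rfl

theorem eulerDeriv (hf : CoeffBigO l ε f) : CoeffBigO l ε (fun i => eulerDeriv (f i)) :=
  fun k => by
    simp only [coeff_eulerDeriv]
    exact (hf k).const_mul_left _

theorem seriesComp (hf : CoeffBigO l ε f) (hg : CoeffBigO l (fun _ => 1) g)
    (hg0 : ∀ i, PowerSeries.constantCoeff (g i) = 0) :
    CoeffBigO l ε (fun i => seriesComp (f i) (g i)) := fun k => by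
  simp only [fun i => coeff_seriesComp (hg0 i) (f i) k]
  refine IsBigO.fun_sum fun p _ => ?_
  simpa using (hf p).mul (hg.pow p k)

end CoeffBigO

/-- The coefficients of an inverse are determined recursively by those of `f` of no higher order.
The cutoff `K` allows use inside an induction where only the coefficients below `K` are controlled
so far. -/
theorem isBigO_coeff_inv {ι : Type*} {l : Filter ι} {f : ι → PowerSeries ℂ} {K : ℕ}
    (hf : ∀ k < K, (fun i => PowerSeries.coeff k (f i)) =O[l] (fun _ => (1 : ℝ)))
    (h0 : (fun i => (PowerSeries.constantCoeff (f i))⁻¹) =O[l] (fun _ => (1 : ℝ))) :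
    ∀ k < K, (fun i => PowerSeries.coeff k (f i)⁻¹) =O[l] (fun _ => (1 : ℝ)) := by
  intro k
  induction k using Nat.strong_induction_on with
  | _ k ih =>
    intro hk
    rw [funext fun i => PowerSeries.coeff_inv k (f i)]
    split_ifs with hk0
    · exact h0
    · simp only [neg_mul]
      refine IsBigO.neg_left ?_
      have : (fun i => ∑ x ∈ Finset.HasAntidiagonal.antidiagonal k, if x.2 < k then
          PowerSeries.coeff x.1 (f i) * PowerSeries.coeff x.2 (f i)⁻¹ else 0)
          =O[l] (fun _ => (1 : ℝ)) := by
        refine IsBigO.fun_sum fun x hx => ?_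
        have hx' := Finset.HasAntidiagonal.mem_antidiagonal.1 hx
        split_ifs with h
        · simpa using (hf x.1 (by omega)).mul (ih x.2 h (by omega))
        · exact isBigO_zero _ _
      simpa using h0.mul this

theorem CoeffBigO.inv {ι : Type*} {l : Filter ι} {f : ι → PowerSeries ℂ}
    (hf : CoeffBigO l (fun _ => 1) f)
    (h0 : (fun i => (PowerSeries.constantCoeff (f i))⁻¹) =O[l] (fun _ => (1 : ℝ))) :
    CoeffBigO l (fun _ => 1) (fun i => (f i)⁻¹) := fun k =>
  isBigO_coeff_inv (K := k + 1) (fun j _ => hf j) h0 k (Nat.lt_succ_self k)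

theorem CoeffBigO.one_add_pow_sub {ι : Type*} {l : Filter ι} {ε : ι → ℝ} {z : ι → PowerSeries ℂ}
    (hz : CoeffBigO l ε z) (hε : ε =O[l] (fun _ => (1 : ℝ))) (k : ℕ) :
    CoeffBigO l (fun i => ε i * ε i) (fun i => (1 + z i) ^ k - 1 - k * z i) := by
  induction k with
  | zero =>
    intro k
    simpa using isBigO_zero _ _
  | succ k ih =>
    have h1 : CoeffBigO l (fun _ => 1) (fun i => 1 + z i) :=
      (CoeffBigO.const 1).add (hz.trans hε)
    -- `(1+z)^(k+1) - 1 - (k+1)z = ((1+z)^k - 1 - kz)(1+z) + k z²`.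
    have h2 := (ih.mul_one h1).add ((CoeffBigO.const (l := l) (k : PowerSeries ℂ)).one_mul
      (hz.mul hz))
    refine h2.congr (Eventually.of_forall fun i => ?_)
    push_cast
    ring

/-! ### Discrete Grönwall estimates along schemes of step `1 / n` -/

/-- The pairs `(n, j)` with `n₀ ≤ n` and `j ≤ c n`. -/
def stepIndex (c : ℕ → ℕ) (n₀ : ℕ) : Set (ℕ × ℕ) := {i | n₀ ≤ i.1 ∧ i.2 ≤ c i.1}

/-- Each step amplifies by at most `1 + A/n` and there are at most `T n` steps, so the total
amplification is at most `exp (A T)`, uniformly in `n`; the sources, each of size `R ε/n`, add up to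
at most `T R ε` before amplification. -/
theorem isBigO_of_step {c : ℕ → ℕ} {n₀ : ℕ} {T : ℝ} (hn₀ : 1 ≤ n₀)
    (hc : ∀ n ≥ n₀, (c n : ℝ) ≤ T * n) {u α r : ℕ × ℕ → ℂ} {ε : ℕ → ℝ}
    (hα : α =O[𝓟 (stepIndex c n₀)] (fun _ => (1 : ℝ)))
    (hr : r =O[𝓟 (stepIndex c n₀)] (fun i => ε i.1))
    {U : ℝ} (h0 : ∀ n ≥ n₀, ‖u (n, 0)‖ ≤ U * ‖ε n‖)
    (hstep : ∀ n ≥ n₀, ∀ j < c n, u (n, j + 1) =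
      u (n, j) + (n : ℂ)⁻¹ * (α (n, j) * u (n, j) + r (n, j))) :
    u =O[𝓟 (stepIndex c n₀)] (fun i => ε i.1) := by
  obtain ⟨A, hA⟩ := isBigO_principal.1 hα
  obtain ⟨R, hR⟩ := isBigO_principal.1 hr
  have hA' : ∀ i ∈ stepIndex c n₀, ‖α i‖ ≤ |A| := fun i hi => by
    have := hA i hi
    simp only [norm_one, mul_one] at this
    exact this.trans (le_abs_self A)
  have hR' : ∀ i ∈ stepIndex c n₀, ‖r i‖ ≤ |R| * ‖ε i.1‖ := fun i hi =>
    (hR i hi).trans (mul_le_mul_of_nonneg_right (le_abs_self R) (norm_nonneg _))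
  -- The sources are charged with the full factor `(1 + |A|/n) ^ j`, more than they incur, so that
  -- the induction closes in one line.
  have key : ∀ n ≥ n₀, ∀ j ≤ c n,
      ‖u (n, j)‖ ≤ (1 + |A| / n) ^ j * (|U| + j * (|R| / n)) * ‖ε n‖ := by
    intro n hn j
    induction j with
    | zero =>
      intro _
      simpa using (h0 n hn).trans
        (mul_le_mul_of_nonneg_right (le_abs_self U) (norm_nonneg _))
    | succ j ih =>
      intro hj
      have hi : (n, j) ∈ stepIndex c n₀ := ⟨hn, by simp only; omega⟩
      have h1 := ih (by omega)
      have hq : (1 : ℝ) ≤ (1 + |A| / n) ^ (j + 1) :=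
        one_le_pow₀ (le_add_of_nonneg_right (by positivity))
      rw [hstep n hn j (by omega)]
      have h2 : ‖u (n, j) + (n : ℂ)⁻¹ * (α (n, j) * u (n, j) + r (n, j))‖ ≤
          ‖u (n, j)‖ + (n : ℝ)⁻¹ * (|A| * ‖u (n, j)‖ + |R| * ‖ε n‖) := by
        refine (norm_add_le _ _).trans (add_le_add le_rfl ?_)
        rw [norm_mul, norm_inv, Complex.norm_natCast]
        refine mul_le_mul_of_nonneg_left ((norm_add_le _ _).trans (add_le_add ?_ ?_))
          (by positivity)
        · rw [norm_mul]
          exact mul_le_mul_of_nonneg_right (hA' _ hi) (norm_nonneg _)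
        · exact hR' _ hi
      have h3 : (n : ℝ)⁻¹ * (|R| * ‖ε n‖) ≤ (1 + |A| / n) ^ (j + 1) * (|R| / n * ‖ε n‖) := by
        have : (n : ℝ)⁻¹ * (|R| * ‖ε n‖) = 1 * (|R| / n * ‖ε n‖) := by
          rw [div_eq_mul_inv]; ring
        rw [this]
        exact mul_le_mul_of_nonneg_right hq (by positivity)
      calc _ ≤ _ := h2
        _ = (1 + |A| / n) * ‖u (n, j)‖ + (n : ℝ)⁻¹ * (|R| * ‖ε n‖) := by
          rw [div_eq_mul_inv]; ring
        _ ≤ (1 + |A| / n) * ((1 + |A| / n) ^ j * (|U| + j * (|R| / n)) * ‖ε n‖) +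
            (1 + |A| / n) ^ (j + 1) * (|R| / n * ‖ε n‖) :=
          add_le_add (mul_le_mul_of_nonneg_left h1 (by positivity)) h3
        _ = _ := by push_cast; ring
  refine isBigO_principal.2 ⟨Real.exp (|A| * T) * (|U| + T * |R|), ?_⟩
  rintro ⟨n, j⟩ ⟨hn, hj⟩
  simp only at hn hj
  have hnpos : (0 : ℝ) < n := by exact_mod_cast (by omega : 0 < n)
  have hjT : (j : ℝ) / n ≤ T := by
    rw [div_le_iff₀ hnpos]
    exact (Nat.cast_le.2 hj).trans (hc n hn)
  refine (key n hn j hj).trans (mul_le_mul_of_nonneg_right ?_ (norm_nonneg _))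
  refine mul_le_mul ?_ ?_ (by positivity) (Real.exp_pos _).le
  · calc (1 + |A| / n) ^ j ≤ (Real.exp (|A| / n)) ^ j :=
          pow_le_pow_left₀ (by positivity) (by rw [add_comm]; exact Real.add_one_le_exp _) j
      _ = Real.exp (|A| * (j / n)) := by rw [← Real.exp_nat_mul]; congr 1; ring
      _ ≤ _ := Real.exp_le_exp.2 (mul_le_mul_of_nonneg_left hjT (abs_nonneg A))
  · have : (j : ℝ) * (|R| / n) = j / n * |R| := by ring
    rw [this]
    gcongr

/-- Isolates the only term containing the top coefficient of `g`; this triangular form is what the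
scalar Grönwall estimate needs. -/
theorem coeff_mul_eq_add_sum (f g : PowerSeries ℂ) (k : ℕ) :
    PowerSeries.coeff k (f * g) = PowerSeries.constantCoeff f * PowerSeries.coeff k g +
      ∑ j ∈ Finset.range k, PowerSeries.coeff (j + 1) f * PowerSeries.coeff (k - (j + 1)) g := by
  rw [PowerSeries.coeff_mul, Finset.Nat.sum_antidiagonal_eq_sum_range_succ
    (fun i j => PowerSeries.coeff i f * PowerSeries.coeff j g), Finset.sum_range_succ']
  simp [add_comm]

/-- The recursion is triangular in the coefficients: at order `k`, lower coefficients of `F` act as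
a source that the induction has already bounded, and the scalar estimate applies. -/
theorem CoeffBigO.of_step {c : ℕ → ℕ} {n₀ : ℕ} {T : ℝ} (hn₀ : 1 ≤ n₀)
    (hc : ∀ n ≥ n₀, (c n : ℝ) ≤ T * n) {F B R : ℕ × ℕ → PowerSeries ℂ} {ε : ℕ → ℝ}
    (hB : CoeffBigO (𝓟 (stepIndex c n₀)) (fun _ => 1) B)
    (hR : CoeffBigO (𝓟 (stepIndex c n₀)) (fun i => ε i.1) R)
    (h0 : ∀ k, ∃ U : ℝ, ∀ n ≥ n₀, ‖PowerSeries.coeff k (F (n, 0))‖ ≤ U * ‖ε n‖)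
    (hstep : ∀ n ≥ n₀, ∀ j < c n, F (n, j + 1) =
      F (n, j) + PowerSeries.C (n : ℂ)⁻¹ * (B (n, j) * F (n, j) + R (n, j))) :
    CoeffBigO (𝓟 (stepIndex c n₀)) (fun i => ε i.1) F := by
  intro k
  induction k using Nat.strong_induction_on with
  | _ k ih =>
    obtain ⟨U, hU⟩ := h0 k
    refine isBigO_of_step hn₀ hc (α := fun i => PowerSeries.constantCoeff (B i))
      (r := fun i => (∑ j ∈ Finset.range k, PowerSeries.coeff (j + 1) (B i) *
        PowerSeries.coeff (k - (j + 1)) (F i)) + PowerSeries.coeff k (R i)) ?_ ?_ hU ?_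
    · simpa using hB 0
    · refine IsBigO.add (IsBigO.fun_sum fun j hj => ?_) (hR k)
      have hj' := Finset.mem_range.1 hj
      simpa using (hB (j + 1)).mul (ih (k - (j + 1)) (by omega))
    · intro n hn j hj
      rw [hstep n hn j hj]
      simp only [map_add, PowerSeries.coeff_C_mul, coeff_mul_eq_add_sum (B (n, j))]
      ring

/-! ### The discrete inverse of the moment scheme -/

/-- The approximate compositional inverse `y / (1 + y) * (1 + h / (a + y)) ^ j`, `h = 1 / n`, of
the moment series after `j` steps. -/
noncomputable def schemeInverse (a : ℕ → ℂ) (i : ℕ × ℕ) : PowerSeries ℂ :=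
  PowerSeries.X * (1 + PowerSeries.X)⁻¹ *
    (1 + PowerSeries.C (i.1 : ℂ)⁻¹ * (PowerSeries.C (a i.1) + PowerSeries.X)⁻¹) ^ i.2

theorem constantCoeff_schemeInverse (a : ℕ → ℂ) (i : ℕ × ℕ) :
    PowerSeries.constantCoeff (schemeInverse a i) = 0 := by
  simp [schemeInverse]

theorem constantCoeff_eulerDeriv (f : PowerSeries ℂ) :
    PowerSeries.constantCoeff (eulerDeriv f) = 0 := by
  simp [eulerDeriv]

/-- A family `ψ (n, j)` of power series which evolves in `j` by an Euler scheme, of step `1 / n`,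
for the equation `∂ψ = - (t ψ') / (a + ψ)`, up to time `c n`. -/
structure IsMomentScheme (c : ℕ → ℕ) (n₀ : ℕ) (T : ℝ) (a : ℕ → ℂ)
    (ψ : ℕ × ℕ → PowerSeries ℂ) : Prop where
  one_le : 1 ≤ n₀
  time_le : ∀ n ≥ n₀, (c n : ℝ) ≤ T * n
  bound : ∃ A : ℝ, ∀ n ≥ n₀, ‖a n‖ ≤ A
  bound_inv : ∃ A : ℝ, ∀ n ≥ n₀, ‖(a n)⁻¹‖ ≤ A
  ne_zero : ∀ n ≥ n₀, a n ≠ 0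
  init : ∀ n ≥ n₀, ψ (n, 0) = (1 - PowerSeries.X)⁻¹ - 1
  step : ∀ n ≥ n₀, ∀ j < c n, ψ (n, j + 1) = ψ (n, j) -
    PowerSeries.C (n : ℂ)⁻¹ * (eulerDeriv (ψ (n, j)) * (PowerSeries.C (a n) + ψ (n, j))⁻¹)

namespace IsMomentScheme

variable {c : ℕ → ℕ} {n₀ : ℕ} {T : ℝ} {a : ℕ → ℂ} {ψ : ℕ × ℕ → PowerSeries ℂ}
  (h : IsMomentScheme c n₀ T a ψ)
include h

theorem isBigO_a : (fun i : ℕ × ℕ => a i.1) =O[𝓟 (stepIndex c n₀)] (fun _ => (1 : ℝ)) := by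
  obtain ⟨A, hA⟩ := h.bound
  exact isBigO_principal.2 ⟨A, fun i hi => by simpa using hA i.1 hi.1⟩

theorem isBigO_a_inv :
    (fun i : ℕ × ℕ => (a i.1)⁻¹) =O[𝓟 (stepIndex c n₀)] (fun _ => (1 : ℝ)) := by
  obtain ⟨A, hA⟩ := h.bound_inv
  exact isBigO_principal.2 ⟨A, fun i hi => by simpa using hA i.1 hi.1⟩

theorem constantCoeff_eq_zero : ∀ i ∈ stepIndex c n₀, PowerSeries.constantCoeff (ψ i) = 0 := by
  rintro ⟨n, j⟩ ⟨hn, hj⟩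
  simp only at hn hj
  induction j with
  | zero => simp [h.init n hn]
  | succ j ih =>
    rw [h.step n hn j (by omega)]
    simp [ih (by omega), constantCoeff_eulerDeriv]

/-- Although the scheme is nonlinear, the `k`-th coefficient obeys a linear recursion with factor
`-k/a` and a source built from lower coefficients, so induction on `k` and Grönwall give bounds
uniform in `n` and `j`. -/
theorem coeffBigO : CoeffBigO (𝓟 (stepIndex c n₀)) (fun _ => 1) ψ := by
  intro k
  induction k using Nat.strong_induction_on with
  | _ k ih =>
    rcases Nat.eq_zero_or_pos k with rfl | hk
    · refine isBigO_principal.2 ⟨0, fun i hi => ?_⟩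
      simp [h.constantCoeff_eq_zero i hi]
    have hinv := isBigO_coeff_inv (l := 𝓟 (stepIndex c n₀)) (K := k)
      (f := fun i => PowerSeries.C (a i.1) + ψ i) (fun m hm => by
        simpa using (CoeffBigO.C h.isBigO_a m).add (ih m hm)) (by
        refine h.isBigO_a_inv.congr' ?_ EventuallyEq.rfl
        filter_upwards [mem_principal_self _] with i hi
        simp [h.constantCoeff_eq_zero i hi])
    -- `t ψ'` has no constant term, so the `k`-th coefficient of `(a + ψ)⁻¹`, which would involve
    -- the `k`-th coefficient of `ψ`, never enters.
    have hdecomp : ∀ i ∈ stepIndex c n₀, PowerSeries.coeff k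
        (eulerDeriv (ψ i) * (PowerSeries.C (a i.1) + ψ i)⁻¹) =
        k * (a i.1)⁻¹ * PowerSeries.coeff k (ψ i) + ∑ j ∈ Finset.range (k - 1),
          PowerSeries.coeff (j + 1) (PowerSeries.C (a i.1) + ψ i)⁻¹ *
            (((k - (j + 1) : ℕ) : ℂ) * PowerSeries.coeff (k - (j + 1)) (ψ i)) := by
      intro i hi
      obtain ⟨m, rfl⟩ : ∃ m, k = m + 1 := ⟨k - 1, by omega⟩
      rw [mul_comm, coeff_mul_eq_add_sum, Finset.sum_range_succ]
      simp only [coeff_eulerDeriv, PowerSeries.constantCoeff_inv, map_add,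
        h.constantCoeff_eq_zero i hi, PowerSeries.constantCoeff_C]
      simp
      ring
    obtain ⟨U, hU⟩ : ∃ U : ℝ, ∀ n ≥ n₀, ‖PowerSeries.coeff k (ψ (n, 0))‖ ≤ U * ‖(1 : ℝ)‖ :=
      ⟨‖PowerSeries.coeff k ((1 - PowerSeries.X)⁻¹ - 1 : PowerSeries ℂ)‖, fun n hn => by
        rw [h.init n hn]; simp⟩
    refine isBigO_of_step h.one_le h.time_le (ε := fun _ => 1)
      (α := fun i => - (k * (a i.1)⁻¹))
      (r := fun i => - ∑ j ∈ Finset.range (k - 1),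
          PowerSeries.coeff (j + 1) (PowerSeries.C (a i.1) + ψ i)⁻¹ *
            (((k - (j + 1) : ℕ) : ℂ) * PowerSeries.coeff (k - (j + 1)) (ψ i))) ?_ ?_ hU ?_
    · exact (h.isBigO_a_inv.const_mul_left _).neg_left
    · refine IsBigO.neg_left (IsBigO.fun_sum fun j hj => ?_)
      have hj' := Finset.mem_range.1 hj
      simpa using (hinv (j + 1) (by omega)).mul
        ((ih (k - (j + 1)) (by omega)).const_mul_left ((k - (j + 1) : ℕ) : ℂ))
    · intro n hn j hj
      have := hdecomp (n, j) ⟨hn, hj.le⟩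
      rw [h.step n hn j hj, map_sub, PowerSeries.coeff_C_mul, this]
      ring

omit h in
theorem isBigO_h : (fun i : ℕ × ℕ => ((i.1 : ℂ))⁻¹) =O[𝓟 (stepIndex c n₀)]
    (fun i => ((i.1 : ℝ))⁻¹) :=
  isBigO_principal.2 ⟨1, fun i _ => by simp⟩

theorem isBigO_h_one : (fun i : ℕ × ℕ => ((i.1 : ℝ))⁻¹) =O[𝓟 (stepIndex c n₀)]
    (fun _ => (1 : ℝ)) :=
  isBigO_principal.2 ⟨1, fun i hi => by
    have h1 : (1 : ℝ) ≤ i.1 := by exact_mod_cast h.one_le.trans hi.1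
    simpa using inv_le_one_of_one_le₀ h1⟩

theorem coeffBigO_w : CoeffBigO (𝓟 (stepIndex c n₀)) (fun _ => 1)
    (fun i => (PowerSeries.C (a i.1) + PowerSeries.X)⁻¹) := by
  refine CoeffBigO.inv ((CoeffBigO.C h.isBigO_a).add (CoeffBigO.const _)) ?_
  simpa using h.isBigO_a_inv

theorem coeffBigO_hw : CoeffBigO (𝓟 (stepIndex c n₀)) (fun i => (i.1 : ℝ)⁻¹)
    (fun i => PowerSeries.C (i.1 : ℂ)⁻¹ * (PowerSeries.C (a i.1) + PowerSeries.X)⁻¹) :=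
  (CoeffBigO.C isBigO_h).mul_one h.coeffBigO_w

theorem coeffBigO_schemeInverse :
    CoeffBigO (𝓟 (stepIndex c n₀)) (fun _ => 1) (schemeInverse a) := by
  refine (CoeffBigO.const _).one_mul ?_
  refine CoeffBigO.of_step h.one_le h.time_le (ε := fun _ => 1) h.coeffBigO_w
    (R := fun _ => 0)
    (fun k => by simp only [map_zero]; exact isBigO_zero _ _) (fun k => ?_) ?_
  · exact ⟨‖PowerSeries.coeff k (1 : PowerSeries ℂ)‖, fun n _ => by simp⟩
  · intro n _ j _
    simp only [pow_succ]
    ring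

/-- The first order Taylor expansion of `f (ψ) ∘ schemeInverse` in the time variable. -/
theorem comp_succ_sub {f : ℕ × ℕ → PowerSeries ℂ}
    (hf : CoeffBigO (𝓟 (stepIndex c n₀)) (fun _ => 1) f) :
    CoeffBigO (𝓟 (stepIndex c n₀)) (fun i => (i.1 : ℝ)⁻¹ * (i.1 : ℝ)⁻¹) (fun i =>
      seriesComp (f i) (schemeInverse a (i.1, i.2 + 1)) - seriesComp (f i) (schemeInverse a i) -
        seriesComp (eulerDeriv (f i)) (schemeInverse a i) *
          (PowerSeries.C (i.1 : ℂ)⁻¹ * (PowerSeries.C (a i.1) + PowerSeries.X)⁻¹)) := by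
  intro N
  set z : ℕ × ℕ → PowerSeries ℂ :=
    fun i => PowerSeries.C (i.1 : ℂ)⁻¹ * (PowerSeries.C (a i.1) + PowerSeries.X)⁻¹ with hz
  -- One time step multiplies the inverse by `1 + z`. In the expansion of `f` in powers of the
  -- inverse, the Euler derivative supplies the factor `k` that cancels the first order term of `(1
  -- + z) ^ k`.
  have key : ∀ i, PowerSeries.coeff N
      (seriesComp (f i) (schemeInverse a (i.1, i.2 + 1)) - seriesComp (f i) (schemeInverse a i) -
        seriesComp (eulerDeriv (f i)) (schemeInverse a i) * z i) =
      ∑ k ∈ Finset.range (N + 1), PowerSeries.coeff k (f i) * PowerSeries.coeff N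
        (schemeInverse a i ^ k * ((1 + z i) ^ k - 1 - (k : PowerSeries ℂ) * z i)) := by
    intro i
    have h0 := constantCoeff_schemeInverse a
    rw [map_sub, map_sub, coeff_seriesComp (h0 _), coeff_seriesComp (h0 _),
      coeff_seriesComp_mul (h0 _), ← Finset.sum_sub_distrib, ← Finset.sum_sub_distrib]
    refine Finset.sum_congr rfl fun k _ => ?_
    have h1 : schemeInverse a (i.1, i.2 + 1) = schemeInverse a i * (1 + z i) := by
      simp only [schemeInverse, hz, pow_succ]; ring
    have h2 : schemeInverse a i ^ k * ((1 + z i) ^ k - 1 - (k : PowerSeries ℂ) * z i) =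
        (schemeInverse a i * (1 + z i)) ^ k - schemeInverse a i ^ k -
          PowerSeries.C (k : ℂ) * (schemeInverse a i ^ k * z i) := by
      rw [mul_pow, map_natCast]; ring
    rw [h1, h2, coeff_eulerDeriv, map_sub, map_sub, PowerSeries.coeff_C_mul]
    ring
  simp only [hz] at key
  simp only [key]
  refine IsBigO.fun_sum fun k _ => ?_
  have := (h.coeffBigO_schemeInverse.pow k).one_mul
    (h.coeffBigO_hw.one_add_pow_sub h.isBigO_h_one k)
  simpa using (hf k).mul (this N)

theorem coeffBigO_d : CoeffBigO (𝓟 (stepIndex c n₀)) (fun _ => 1)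
    (fun i => seriesComp (eulerDeriv (ψ i)) (schemeInverse a i)) :=
  h.coeffBigO.eulerDeriv.seriesComp h.coeffBigO_schemeInverse (constantCoeff_schemeInverse a)

theorem coeffBigO_inv :
    CoeffBigO (𝓟 (stepIndex c n₀)) (fun _ => 1) (fun i => (PowerSeries.C (a i.1) + ψ i)⁻¹) := by
  refine CoeffBigO.inv ((CoeffBigO.C h.isBigO_a).add h.coeffBigO) ?_
  refine h.isBigO_a_inv.congr' ?_ EventuallyEq.rfl
  filter_upwards [mem_principal_self _] with i hi
  simp [h.constantCoeff_eq_zero i hi]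

/-- At time zero the moment series is that of `δ_1`, namely `t/(1-t)`, with exact inverse `y/(1+y)`.
-/
theorem comp_init : ∀ n ≥ n₀, seriesComp (ψ (n, 0)) (schemeInverse a (n, 0)) = PowerSeries.X := by
  intro n hn
  have h0 := constantCoeff_schemeInverse a (n, 0)
  have h1 : (PowerSeries.constantCoeff (1 - PowerSeries.X : PowerSeries ℂ)) ≠ 0 := by simp
  have h2 := seriesComp_inv h0 h1
  rw [h.init n hn, seriesComp_sub h0, seriesComp_one h0]
  rw [seriesComp_sub h0, seriesComp_one h0, seriesComp_X h0] at h2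
  have h3 : schemeInverse a (n, 0) = PowerSeries.X * (1 + PowerSeries.X)⁻¹ := by
    simp [schemeInverse]
  have h4 : (1 + PowerSeries.X : PowerSeries ℂ) * (1 + PowerSeries.X)⁻¹ = 1 :=
    PowerSeries.mul_inv_cancel _ (by simp)
  have h5 : (1 : PowerSeries ℂ) - schemeInverse a (n, 0) = (1 + PowerSeries.X)⁻¹ := by
    rw [h3]; linear_combination - h4
  rw [h5] at h2
  linear_combination (1 + PowerSeries.X) * h2 -
    seriesComp (1 - PowerSeries.X)⁻¹ (schemeInverse a (n, 0)) * h4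

/-- Write `g = ψ ∘ χ` at the current step, `D = (tψ') ∘ χ`, `W = 1/(a+y)` and `V = 1/(a+g)`. Moving
`χ` forward adds `D W/n`, moving `ψ` forward subtracts `D V/n`, each up to `O(1/n²)`. Since `W - V =
W V (g - y)`, the error `g - y` satisfies a linear recursion with bounded factor `D W V` and starts
at zero. -/
theorem comp_sub_X :
    CoeffBigO (𝓟 (stepIndex c n₀)) (fun i => (i.1 : ℝ)⁻¹)
      (fun i => seriesComp (ψ i) (schemeInverse a i) - PowerSeries.X) := by
  have h0 := constantCoeff_schemeInverse a
  set p : ℕ × ℕ → PowerSeries ℂ :=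
    fun i => eulerDeriv (ψ i) * (PowerSeries.C (a i.1) + ψ i)⁻¹ with hp
  have hpB : CoeffBigO (𝓟 (stepIndex c n₀)) (fun _ => 1) p :=
    h.coeffBigO.eulerDeriv.mul_one h.coeffBigO_inv
  set W : ℕ × ℕ → PowerSeries ℂ := fun i => (PowerSeries.C (a i.1) + PowerSeries.X)⁻¹ with hW
  set V : ℕ × ℕ → PowerSeries ℂ :=
    fun i => seriesComp (PowerSeries.C (a i.1) + ψ i)⁻¹ (schemeInverse a i) with hV
  set d : ℕ × ℕ → PowerSeries ℂ :=
    fun i => seriesComp (eulerDeriv (ψ i)) (schemeInverse a i) with hd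
  set R₁ : ℕ × ℕ → PowerSeries ℂ := fun i =>
      seriesComp (ψ i) (schemeInverse a (i.1, i.2 + 1)) - seriesComp (ψ i) (schemeInverse a i) -
        d i * (PowerSeries.C (i.1 : ℂ)⁻¹ * W i) with hR₁
  have hR₁B := h.comp_succ_sub h.coeffBigO
  set R₂ : ℕ × ℕ → PowerSeries ℂ := fun i =>
      seriesComp (p i) (schemeInverse a (i.1, i.2 + 1)) - seriesComp (p i) (schemeInverse a i)
    with hR₂
  -- First order suffices here, because `R₂` enters the recursion with an extra factor `1/n`; `R₁`
  -- does not, and needs the second order bound.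
  have hR₂B : CoeffBigO (𝓟 (stepIndex c n₀)) (fun i => (i.1 : ℝ)⁻¹) R₂ := by
    have e1 := (h.comp_succ_sub hpB).trans (δ := fun i => (i.1 : ℝ)⁻¹) (by
      simpa using (isBigO_refl (fun i : ℕ × ℕ => (i.1 : ℝ)⁻¹) _).mul h.isBigO_h_one)
    have e2 := (hpB.eulerDeriv.seriesComp h.coeffBigO_schemeInverse h0).one_mul h.coeffBigO_hw
    refine (e1.add e2).congr (Eventually.of_forall fun i => ?_)
    simp only [hR₂]
    ring
  have hnR₁ : CoeffBigO (𝓟 (stepIndex c n₀)) (fun i => (i.1 : ℝ)⁻¹)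
      (fun i => PowerSeries.C (i.1 : ℂ) * R₁ i) := by
    have e1 : (fun i : ℕ × ℕ => (i.1 : ℂ)) =O[𝓟 (stepIndex c n₀)] (fun i => (i.1 : ℝ)) :=
      isBigO_principal.2 ⟨1, fun i _ => by simp⟩
    refine ((CoeffBigO.C e1).mul hR₁B).trans (isBigO_principal.2 ⟨1, fun i hi => ?_⟩)
    have : (i.1 : ℝ) ≠ 0 := by
      have := h.one_le.trans hi.1
      exact_mod_cast (by omega : i.1 ≠ 0)
    rw [mul_inv_cancel_left₀ this, one_mul]
  refine CoeffBigO.of_step h.one_le h.time_le (ε := fun n => (n : ℝ)⁻¹)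
    (B := fun i => d i * (W i * V i)) (R := fun i => PowerSeries.C (i.1 : ℂ) * R₁ i - R₂ i)
    ?_ (hnR₁.sub hR₂B) (fun k => ⟨0, fun n hn => ?_⟩) ?_
  · exact h.coeffBigO_d.mul_one (h.coeffBigO_w.mul_one
      (h.coeffBigO_inv.seriesComp h.coeffBigO_schemeInverse h0))
  · simp [h.comp_init n hn]
  · intro n hn j hj
    have hn0 : (n : ℂ) ≠ 0 := by
      have := h.one_le
      exact_mod_cast (by omega : n ≠ 0)
    have hi : (n, j) ∈ stepIndex c n₀ := ⟨hn, hj.le⟩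
    have e1 : seriesComp (p (n, j)) (schemeInverse a (n, j)) = d (n, j) * V (n, j) := by
      simp only [hp, hd, hV]
      rw [seriesComp_mul (h0 _)]
    have e2 : (PowerSeries.C (a n) + PowerSeries.X) * W (n, j) = 1 :=
      PowerSeries.mul_inv_cancel _ (by simpa using h.ne_zero n hn)
    have e3 : V (n, j) * (PowerSeries.C (a n) + seriesComp (ψ (n, j)) (schemeInverse a (n, j)))
        = 1 := by
      rw [← seriesComp_C (h0 (n, j)) (a n), ← seriesComp_add (h0 _)]
      refine seriesComp_inv (h0 _) ?_
      simpa [h.constantCoeff_eq_zero _ hi] using h.ne_zero n hn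
    have e4 : (PowerSeries.C (n : ℂ)⁻¹ * PowerSeries.C (n : ℂ) : PowerSeries ℂ) = 1 := by
      rw [← map_mul, inv_mul_cancel₀ hn0, map_one]
    have e5 : seriesComp (ψ (n, j + 1)) (schemeInverse a (n, j + 1)) =
        seriesComp (ψ (n, j)) (schemeInverse a (n, j + 1)) -
          PowerSeries.C (n : ℂ)⁻¹ * seriesComp (p (n, j)) (schemeInverse a (n, j + 1)) := by
      rw [h.step n hn j hj, seriesComp_sub (h0 _), seriesComp_mul (h0 _), seriesComp_C (h0 _)]
    have e6 : seriesComp (p (n, j)) (schemeInverse a (n, j + 1)) =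
        R₂ (n, j) + d (n, j) * V (n, j) := by
      rw [← e1]; simp only [hR₂]; ring
    have e7 : seriesComp (ψ (n, j)) (schemeInverse a (n, j + 1)) = R₁ (n, j) +
        seriesComp (ψ (n, j)) (schemeInverse a (n, j)) +
          d (n, j) * (PowerSeries.C (n : ℂ)⁻¹ * W (n, j)) := by
      simp only [hR₁]; ring
    rw [e5, e6, e7]
    generalize seriesComp (ψ (n, j)) (schemeInverse a (n, j)) = g at *
    generalize V (n, j) = v at *
    generalize W (n, j) = w at *
    generalize d (n, j) = D at *
    generalize R₁ (n, j) = r at *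
    simp only
    linear_combination (-r) * e4 - PowerSeries.C (n : ℂ)⁻¹ * D * w * e3 +
      PowerSeries.C (n : ℂ)⁻¹ * D * v * e2

end IsMomentScheme

/-! ### Taylor series at the origin -/

/-- The Taylor series of `f` at `0`, as a formal power series. -/
noncomputable def taylorSeries (f : ℂ → ℂ) : PowerSeries ℂ :=
  PowerSeries.mk fun k => iteratedDeriv k f 0 / (k.factorial : ℂ)

theorem coeff_taylorSeries (f : ℂ → ℂ) (k : ℕ) :
    PowerSeries.coeff k (taylorSeries f) = iteratedDeriv k f 0 / (k.factorial : ℂ) :=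
  PowerSeries.coeff_mk _ _

theorem constantCoeff_taylorSeries (f : ℂ → ℂ) :
    PowerSeries.constantCoeff (taylorSeries f) = f 0 := by
  simp [← PowerSeries.coeff_zero_eq_constantCoeff_apply, coeff_taylorSeries]

theorem taylorSeries_congr {f g : ℂ → ℂ} (h : f =ᶠ[𝓝 0] g) : taylorSeries f = taylorSeries g := by
  ext k
  rw [coeff_taylorSeries, coeff_taylorSeries, h.iteratedDeriv_eq k]

theorem derivative_taylorSeries (f : ℂ → ℂ) :
    PowerSeries.derivative ℂ (taylorSeries f) = taylorSeries (deriv f) := by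
  ext k
  rw [PowerSeries.coeff_derivative, coeff_taylorSeries, coeff_taylorSeries, iteratedDeriv_succ',
    Nat.factorial_succ]
  have h1 : (k.factorial : ℂ) ≠ 0 := by exact_mod_cast k.factorial_ne_zero
  have h2 : ((k : ℂ) + 1) ≠ 0 := by exact_mod_cast k.succ_ne_zero
  push_cast
  field_simp

theorem taylorSeries_const (a : ℂ) : taylorSeries (fun _ => a) = PowerSeries.C a := by
  ext k
  rw [coeff_taylorSeries, iteratedDeriv_const, PowerSeries.coeff_C]
  split_ifs with h <;> simp [h]

theorem taylorSeries_id : taylorSeries (fun y => y) = PowerSeries.X := by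
  refine PowerSeries.derivative.ext (R := ℂ) ?_ ?_
  · rw [derivative_taylorSeries, PowerSeries.derivative_X]
    have : deriv (fun y : ℂ => y) = fun _ => 1 := by ext y; simp
    rw [this, taylorSeries_const, map_one]
  · simp [constantCoeff_taylorSeries]

theorem taylorSeries_mul {f g : ℂ → ℂ} (hf : AnalyticAt ℂ f 0) (hg : AnalyticAt ℂ g 0) :
    taylorSeries (fun y => f y * g y) = taylorSeries f * taylorSeries g := by
  ext k
  rw [coeff_taylorSeries, iteratedDeriv_fun_mul hf.contDiffAt hg.contDiffAt, PowerSeries.coeff_mul,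
    Finset.Nat.sum_antidiagonal_eq_sum_range_succ
      (fun i j => PowerSeries.coeff i (taylorSeries f) * PowerSeries.coeff j (taylorSeries g)),
    Finset.sum_div]
  refine Finset.sum_congr rfl fun i hi => ?_
  have hik : i ≤ k := by
    have := Finset.mem_range.1 hi
    omega
  have h0 : (i.factorial : ℂ) ≠ 0 := by exact_mod_cast i.factorial_ne_zero
  have h1 : (k.factorial : ℂ) ≠ 0 := by exact_mod_cast k.factorial_ne_zero
  have h2 : ((k - i).factorial : ℂ) ≠ 0 := by exact_mod_cast (k - i).factorial_ne_zero
  have h3 : (k.choose i : ℂ) * i.factorial * (k - i).factorial = k.factorial := by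
    exact_mod_cast Nat.choose_mul_factorial_mul_factorial hik
  rw [coeff_taylorSeries, coeff_taylorSeries, ← h3]
  have h4 : (k.choose i : ℂ) ≠ 0 := by
    intro h
    rw [h] at h3
    simp at h3
    exact h1 h3.symm
  field_simp

theorem taylorSeries_add {f g : ℂ → ℂ} (hf : AnalyticAt ℂ f 0) (hg : AnalyticAt ℂ g 0) :
    taylorSeries (fun y => f y + g y) = taylorSeries f + taylorSeries g := by
  ext k
  rw [map_add, coeff_taylorSeries, coeff_taylorSeries, coeff_taylorSeries,
    iteratedDeriv_fun_add hf.contDiffAt hg.contDiffAt, add_div]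

theorem taylorSeries_comp {f g : ℂ → ℂ} (hf : AnalyticAt ℂ f 0) (hg : AnalyticAt ℂ g 0)
    (hg0 : g 0 = 0) :
    taylorSeries (fun y => f (g y)) = seriesComp (taylorSeries f) (taylorSeries g) := by
  have h0 : PowerSeries.constantCoeff (taylorSeries g) = 0 := by
    rw [constantCoeff_taylorSeries, hg0]
  -- The induction runs over all `f` at once: the chain rule holds for functions and for formal
  -- series, so the coefficient of order `N + 1` follows from those of order at most `N` for `deriv
  -- f`.
  have key : ∀ N : ℕ, ∀ f : ℂ → ℂ, AnalyticAt ℂ f 0 → ∀ k ≤ N,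
      PowerSeries.coeff k (taylorSeries (fun y => f (g y))) =
        PowerSeries.coeff k (seriesComp (taylorSeries f) (taylorSeries g)) := by
    intro N
    induction N with
    | zero =>
      intro f _ k hk
      obtain rfl : k = 0 := by omega
      rw [PowerSeries.coeff_zero_eq_constantCoeff_apply,
        PowerSeries.coeff_zero_eq_constantCoeff_apply, constantCoeff_seriesComp h0,
        constantCoeff_taylorSeries, constantCoeff_taylorSeries, hg0]
    | succ N ih =>
      intro f hf k hk
      rcases Nat.lt_or_ge k (N + 1) with hk' | hk'
      · exact ih f hf k (by omega)
      obtain rfl : k = N + 1 := by omega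
      have hfg : AnalyticAt ℂ (fun y => deriv f (g y)) 0 :=
        AnalyticAt.comp (g := deriv f) (by rw [hg0]; exact hf.deriv) hg
      have hd : deriv (fun y => f (g y)) =ᶠ[𝓝 0] fun y => deriv f (g y) * deriv g y := by
        have hf' : ∀ᶠ y in 𝓝 (0 : ℂ), AnalyticAt ℂ f (g y) := by
          have := hf.eventually_analyticAt
          rw [← hg0] at this
          exact hg.continuousAt.eventually this
        filter_upwards [hg.eventually_analyticAt, hf'] with y hy1 hy2
        exact deriv_comp y hy2.differentiableAt hy1.differentiableAt
      have h1 : PowerSeries.derivative ℂ (taylorSeries (fun y => f (g y))) =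
          taylorSeries (fun y => deriv f (g y)) * taylorSeries (deriv g) := by
        rw [derivative_taylorSeries, taylorSeries_congr hd, taylorSeries_mul hfg hg.deriv]
      have h2 : PowerSeries.derivative ℂ (seriesComp (taylorSeries f) (taylorSeries g)) =
          seriesComp (taylorSeries (deriv f)) (taylorSeries g) * taylorSeries (deriv g) := by
        rw [seriesComp, PowerSeries.derivative_subst (hasSubst_of_constantCoeff h0),
          derivative_taylorSeries, derivative_taylorSeries]
        rfl
      have h3 : PowerSeries.coeff N (PowerSeries.derivative ℂ (taylorSeries (fun y => f (g y)))) =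
          PowerSeries.coeff N
            (PowerSeries.derivative ℂ (seriesComp (taylorSeries f) (taylorSeries g))) := by
        rw [h1, h2, PowerSeries.coeff_mul, PowerSeries.coeff_mul]
        refine Finset.sum_congr rfl fun p hp => ?_
        have := Finset.HasAntidiagonal.mem_antidiagonal.1 hp
        rw [ih (deriv f) hf.deriv p.1 (by omega)]
      rw [PowerSeries.coeff_derivative, PowerSeries.coeff_derivative] at h3
      exact mul_right_cancel₀ (by exact_mod_cast N.succ_ne_zero) h3
  ext k
  exact key k f hf k le_rfl

theorem AnalyticAt.eventually_hasSum_taylorSeries {f : ℂ → ℂ} (hf : AnalyticAt ℂ f 0) :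
    ∀ᶠ t in 𝓝 (0 : ℂ), HasSum (fun k => PowerSeries.coeff k (taylorSeries f) * t ^ k) (f t) := by
  have := hasFPowerSeriesAt_iff.1 hf.hasFPowerSeriesAt
  filter_upwards [this] with t ht
  simpa [coeff_taylorSeries, mul_comm] using ht

/-- The terms of the Taylor series are bounded at a point of convergence. Applied to the limiting
moment series, this exponential bound yields a compactly supported limit law. -/
theorem AnalyticAt.norm_coeff_taylorSeries_le {f : ℂ → ℂ} (hf : AnalyticAt ℂ f 0) :
    ∃ C R : ℝ, 0 < R ∧ ∀ k, ‖PowerSeries.coeff k (taylorSeries f)‖ ≤ C * R ^ k := by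
  obtain ⟨δ, hδ, h⟩ := Metric.eventually_nhds_iff.1 hf.eventually_hasSum_taylorSeries
  have hs := h (y := ((δ / 2 : ℝ) : ℂ)) (by
    rw [dist_zero_right, Complex.norm_real, Real.norm_of_nonneg (by positivity)]; linarith)
  obtain ⟨C, hC⟩ := hs.summable.tendsto_atTop_zero.norm.bddAbove_range
  refine ⟨C, (δ / 2)⁻¹, by positivity, fun k => ?_⟩
  have := hC ⟨k, rfl⟩
  simp only [norm_mul, norm_pow, Complex.norm_real] at this
  rw [Real.norm_of_nonneg (by positivity : (0 : ℝ) ≤ δ / 2)] at this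
  rw [inv_pow, ← div_eq_mul_inv, le_div_iff₀ (by positivity)]
  exact this

/-! ### Coefficientwise convergence -/

/-- Coefficientwise convergence of formal power series. -/
def CoeffTendsto {ι : Type*} (l : Filter ι) (f : ι → PowerSeries ℂ) (F : PowerSeries ℂ) : Prop :=
  ∀ k, Tendsto (fun i => PowerSeries.coeff k (f i)) l (𝓝 (PowerSeries.coeff k F))

namespace CoeffTendsto

variable {ι : Type*} {l : Filter ι} {f g : ι → PowerSeries ℂ} {F G : PowerSeries ℂ}

theorem const (F : PowerSeries ℂ) : CoeffTendsto l (fun _ => F) F := fun _ => tendsto_const_nhds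

theorem add (hf : CoeffTendsto l f F) (hg : CoeffTendsto l g G) :
    CoeffTendsto l (fun i => f i + g i) (F + G) := fun k => by
  simpa using (hf k).add (hg k)

theorem mul (hf : CoeffTendsto l f F) (hg : CoeffTendsto l g G) :
    CoeffTendsto l (fun i => f i * g i) (F * G) := fun k => by
  simp only [PowerSeries.coeff_mul]
  exact tendsto_finsetSum _ fun p _ => (hf p.1).mul (hg p.2)

theorem pow (hf : CoeffTendsto l f F) (n : ℕ) : CoeffTendsto l (fun i => f i ^ n) (F ^ n) := by
  induction n with
  | zero => simpa using const (l := l) 1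
  | succ n ih => simpa [pow_succ] using ih.mul hf

theorem C {a : ι → ℂ} {α : ℂ} (ha : Tendsto a l (𝓝 α)) :
    CoeffTendsto l (fun i => PowerSeries.C (a i)) (PowerSeries.C α) := by
  intro k
  cases k with
  | zero => simpa using ha
  | succ k => simpa using tendsto_const_nhds

theorem congr (hf : CoeffTendsto l f F) (h : f =ᶠ[l] g) : CoeffTendsto l g F := fun k =>
  (hf k).congr' (h.mono fun i hi => by simp only [hi])

theorem inv (hf : CoeffTendsto l f F) (h0 : PowerSeries.constantCoeff F ≠ 0) :
    CoeffTendsto l (fun i => (f i)⁻¹) F⁻¹ := by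
  have hc : Tendsto (fun i => (PowerSeries.constantCoeff (f i))⁻¹) l
      (𝓝 (PowerSeries.constantCoeff F)⁻¹) := by
    have := hf 0
    simp only [PowerSeries.coeff_zero_eq_constantCoeff] at this
    exact this.inv₀ h0
  intro k
  induction k using Nat.strong_induction_on with
  | _ k ih =>
    rw [funext fun i => PowerSeries.coeff_inv k (f i), PowerSeries.coeff_inv k F]
    split_ifs with hk0
    · exact hc
    · refine Tendsto.mul hc.neg (tendsto_finsetSum _ fun x _ => ?_)
      split_ifs with h
      · exact (hf x.1).mul (ih x.2 h)
      · exact tendsto_const_nhds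

/-- Convergence of power series satisfying linear first order differential equations. -/
theorem of_derivative (h0 : Tendsto (fun i => PowerSeries.constantCoeff (f i)) l
      (𝓝 (PowerSeries.constantCoeff F)))
    (hg : CoeffTendsto l g G) (hf : ∀ᶠ i in l, PowerSeries.derivative ℂ (f i) = g i * f i)
    (hF : PowerSeries.derivative ℂ F = G * F) : CoeffTendsto l f F := by
  -- The differential equation expresses each coefficient through lower ones, so the constant term
  -- and the convergence of `g` determine everything.
  have hcoeff : ∀ p q : PowerSeries ℂ, PowerSeries.derivative ℂ p = q * p → ∀ k,
      PowerSeries.coeff (k + 1) p =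
        ((k : ℂ) + 1)⁻¹ * ∑ x ∈ Finset.HasAntidiagonal.antidiagonal k,
          PowerSeries.coeff x.1 q * PowerSeries.coeff x.2 p := by
    intro p q h k
    rw [← PowerSeries.coeff_mul, ← h, PowerSeries.coeff_derivative]
    have : ((k : ℂ) + 1) ≠ 0 := by exact_mod_cast k.succ_ne_zero
    field_simp
  intro k
  induction k using Nat.strong_induction_on with
  | _ k ih =>
    cases k with
    | zero => simpa using h0
    | succ k =>
      rw [hcoeff F G hF k]
      refine Tendsto.congr' (hf.mono fun i hi => (hcoeff (f i) (g i) hi k).symm) ?_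
      refine Tendsto.const_mul _ (tendsto_finsetSum _ fun x hx => ?_)
      have := Finset.HasAntidiagonal.mem_antidiagonal.1 hx
      exact (hg x.1).mul (ih x.2 (by omega))

/-- If `f i ∘ g i → F ∘ G` and `g i → G`, with `G` invertible for composition, then `f i → F`. -/
theorem of_seriesComp (hg0 : ∀ i, PowerSeries.constantCoeff (g i) = 0)
    (hG0 : PowerSeries.constantCoeff G = 0) (hG1 : PowerSeries.coeff 1 G ≠ 0)
    (hg : CoeffTendsto l g G)
    (h : CoeffTendsto l (fun i => seriesComp (f i) (g i)) (seriesComp F G)) :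
    CoeffTendsto l f F := by
  have hdiag : ∀ p : PowerSeries ℂ, PowerSeries.constantCoeff p = 0 → ∀ N,
      PowerSeries.coeff N (p ^ N) = PowerSeries.coeff 1 p ^ N := by
    intro p hp N
    obtain ⟨q, rfl⟩ := PowerSeries.X_dvd_iff.2 hp
    have h1 := PowerSeries.coeff_X_pow_mul (q ^ N) N 0
    have h2 := PowerSeries.coeff_succ_X_mul 0 q
    rw [zero_add] at h1 h2
    rw [mul_pow, h1, h2]
    simp
  intro N
  induction N using Nat.strong_induction_on with
  | _ N ih =>
    have hN : PowerSeries.coeff N (G ^ N) ≠ 0 := by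
      rw [hdiag G hG0]
      exact pow_ne_zero _ hG1
    -- Composition is triangular, with diagonal entry the `N`-th power of the linear coefficient of
    -- `q`; solving for the top coefficient of `p` allows the limit to be taken by induction.
    have hform : ∀ p q : PowerSeries ℂ, PowerSeries.constantCoeff q = 0 →
        PowerSeries.coeff N (q ^ N) ≠ 0 → PowerSeries.coeff N p =
        (PowerSeries.coeff N (seriesComp p q) - ∑ k ∈ Finset.range N,
          PowerSeries.coeff k p * PowerSeries.coeff N (q ^ k)) / PowerSeries.coeff N (q ^ N) := by
      intro p q hq hqN
      rw [coeff_seriesComp hq, Finset.sum_range_succ]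
      field_simp
      ring
    rw [hform F G hG0 hN]
    have hlim := hg.pow N N
    refine Tendsto.congr' ?_ (((h N).sub (tendsto_finsetSum _ fun k hk =>
      (ih k (Finset.mem_range.1 hk)).mul (hg.pow k N))).div hlim hN)
    filter_upwards [hlim.eventually_ne hN] with i hi
    exact (hform (f i) (g i) (hg0 i) hi).symm

end CoeffTendsto

/-! ### The limit of the discrete inverses -/

/-- The function `y / (1 + y) * exp (γ / (α + y))`. -/
noncomputable def limitInverse (α γ y : ℂ) : ℂ := y / (1 + y) * Complex.exp (γ / (α + y))

section limitInverse

variable {α : ℂ} (hα : α ≠ 0) (γ : ℂ)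
include hα

theorem analyticAt_exp_div : AnalyticAt ℂ (fun y => Complex.exp (γ / (α + y))) 0 := by
  have : AnalyticAt ℂ (fun y => γ / (α + y)) 0 :=
    analyticAt_const.div (analyticAt_const.add analyticAt_id) (by simpa using hα)
  exact this.cexp

theorem analyticAt_limitInverse : AnalyticAt ℂ (limitInverse α γ) 0 := by
  have : AnalyticAt ℂ (fun y : ℂ => y / (1 + y)) 0 :=
    analyticAt_id.div (analyticAt_const.add analyticAt_id) (by simp)
  exact this.mul (analyticAt_exp_div hα γ)

theorem taylorSeries_add_inv : taylorSeries (fun y => (α + y)⁻¹) =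
    (PowerSeries.C α + PowerSeries.X)⁻¹ := by
  have h1 : AnalyticAt ℂ (fun y => α + y) 0 := analyticAt_const.add analyticAt_id
  have h2 : AnalyticAt ℂ (fun y => (α + y)⁻¹) 0 := h1.inv (by simpa using hα)
  have hid : AnalyticAt ℂ (fun y : ℂ => y) 0 := analyticAt_id
  have h3 : taylorSeries (fun y => α + y) = PowerSeries.C α + PowerSeries.X := by
    rw [taylorSeries_add analyticAt_const hid, taylorSeries_const, taylorSeries_id]
  have h4 : taylorSeries (fun y => (α + y)⁻¹ * (α + y)) = 1 := by
    have : (fun y => (α + y)⁻¹ * (α + y)) =ᶠ[𝓝 0] fun _ => (1 : ℂ) := by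
      filter_upwards [h1.continuousAt.eventually_ne (by simpa using hα : α + 0 ≠ 0)] with y hy
      exact inv_mul_cancel₀ hy
    rw [taylorSeries_congr this, taylorSeries_const, map_one]
  rw [taylorSeries_mul h2 h1, h3] at h4
  rw [PowerSeries.eq_inv_iff_mul_eq_one (by simpa using hα), h4]

theorem taylorSeries_limitInverse : taylorSeries (limitInverse α γ) =
    PowerSeries.X * (1 + PowerSeries.X)⁻¹ * taylorSeries (fun y => Complex.exp (γ / (α + y))) := by
  have h1 : AnalyticAt ℂ (fun y : ℂ => (1 + y)⁻¹) 0 :=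
    (analyticAt_const.add analyticAt_id).inv (by simp)
  have h2 := taylorSeries_add_inv (one_ne_zero (α := ℂ))
  have hid : AnalyticAt ℂ (fun y : ℂ => y) 0 := analyticAt_id
  have h3 : taylorSeries (fun y => y * (1 + y)⁻¹) =
      PowerSeries.X * (1 + PowerSeries.X)⁻¹ := by
    rw [taylorSeries_mul hid h1, h2, map_one, taylorSeries_id]
  have h4 : AnalyticAt ℂ (fun y : ℂ => y * (1 + y)⁻¹) 0 := hid.mul h1
  rw [← h3, ← taylorSeries_mul h4 (analyticAt_exp_div hα γ)]
  rfl

theorem derivative_taylorSeries_exp_div :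
    PowerSeries.derivative ℂ (taylorSeries (fun y => Complex.exp (γ / (α + y)))) =
      - (PowerSeries.C γ * ((PowerSeries.C α + PowerSeries.X)⁻¹ *
        (PowerSeries.C α + PowerSeries.X)⁻¹)) *
        taylorSeries (fun y => Complex.exp (γ / (α + y))) := by
  have h1 : AnalyticAt ℂ (fun y => α + y) 0 := analyticAt_const.add analyticAt_id
  have h2 : AnalyticAt ℂ (fun y => (α + y)⁻¹) 0 := h1.inv (by simpa using hα)
  have hd : deriv (fun y => Complex.exp (γ / (α + y))) =ᶠ[𝓝 0]
      fun y => (-γ * ((α + y)⁻¹ * (α + y)⁻¹)) * Complex.exp (γ / (α + y)) := by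
    filter_upwards [h1.continuousAt.eventually_ne (by simpa using hα : α + 0 ≠ 0)] with y hy
    have e1 : HasDerivAt (fun y => α + y) 1 y := (hasDerivAt_id y).const_add α
    have e2 : HasDerivAt (fun y => Complex.exp (γ / (α + y)))
        (Complex.exp (γ / (α + y)) * ((0 * (α + y) - γ * 1) / (α + y) ^ 2)) y :=
      ((hasDerivAt_const y γ).div e1 hy).cexp
    rw [e2.deriv]
    field_simp
    ring
  have h3 : AnalyticAt ℂ (fun y => (α + y)⁻¹ * (α + y)⁻¹) 0 := h2.mul h2
  have h4 : AnalyticAt ℂ (fun y => -γ * ((α + y)⁻¹ * (α + y)⁻¹)) 0 := analyticAt_const.mul h3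
  rw [derivative_taylorSeries, taylorSeries_congr hd,
    taylorSeries_mul h4 (analyticAt_exp_div hα γ),
    taylorSeries_mul analyticAt_const h3, taylorSeries_mul h2 h2,
    taylorSeries_add_inv hα, taylorSeries_const, map_neg]
  ring

theorem coeff_one_taylorSeries_limitInverse :
    PowerSeries.coeff 1 (taylorSeries (limitInverse α γ)) = Complex.exp (γ / α) := by
  rw [taylorSeries_limitInverse hα, mul_assoc]
  have := PowerSeries.coeff_succ_X_mul 0 ((1 + PowerSeries.X)⁻¹ *
    taylorSeries (fun y => Complex.exp (γ / (α + y))))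
  rw [zero_add] at this
  rw [this]
  simp [constantCoeff_taylorSeries]

/-- The local inverse of `limitInverse`, together with its Taylor series. -/
theorem exists_localInverse : ∃ ψ : ℂ → ℂ, AnalyticAt ℂ ψ 0 ∧ ψ 0 = 0 ∧
    (∀ᶠ t in 𝓝 0, limitInverse α γ (ψ t) = t) ∧
    seriesComp (taylorSeries ψ) (taylorSeries (limitInverse α γ)) = PowerSeries.X := by
  have hχ := analyticAt_limitInverse hα γ
  have hχ0 : limitInverse α γ 0 = 0 := by simp [limitInverse]
  have hχ' : deriv (limitInverse α γ) 0 ≠ 0 := by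
    have := coeff_one_taylorSeries_limitInverse hα γ
    rw [coeff_taylorSeries, iteratedDeriv_one] at this
    intro h
    rw [h] at this
    simp only [zero_div] at this
    exact Complex.exp_ne_zero _ this.symm
  set ψ := hχ.hasStrictDerivAt.localInverse _ _ _ hχ' with hψ
  have hψa : AnalyticAt ℂ ψ 0 := by
    have := hχ.analyticAt_localInverse hχ'
    rwa [hχ0] at this
  have hright : ∀ᶠ t in 𝓝 0, limitInverse α γ (ψ t) = t := by
    have := hχ.hasStrictDerivAt.eventually_right_inverse hχ'
    rwa [hχ0] at this
  have hleft : ∀ᶠ y in 𝓝 0, ψ (limitInverse α γ y) = y :=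
    (hχ.hasStrictDerivAt.hasStrictFDerivAt_equiv hχ').eventually_left_inverse
  refine ⟨ψ, hψa, ?_, hright, ?_⟩
  · have := hleft.self_of_nhds
    rwa [hχ0] at this
  · rw [← taylorSeries_comp hψa hχ hχ0, taylorSeries_congr hleft, taylorSeries_id]

end limitInverse

theorem tendsto_one_add_inv_pow {a : ℕ → ℂ} {c : ℕ → ℕ} {α γ : ℂ} (hα : α ≠ 0)
    (ha : Tendsto a atTop (𝓝 α)) (hc : Tendsto (fun n => (c n : ℂ) / n) atTop (𝓝 γ)) :
    Tendsto (fun n : ℕ => (1 + (n : ℂ)⁻¹ * (a n)⁻¹) ^ c n) atTop (𝓝 (Complex.exp (γ / α))) := by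
  have hh : Tendsto (fun n : ℕ => (n : ℂ)⁻¹) atTop (𝓝 0) := tendsto_inv_atTop_nhds_zero_nat
  have hg : Tendsto (fun n : ℕ => (n : ℂ) * ((n : ℂ)⁻¹ * (a n)⁻¹)) atTop (𝓝 α⁻¹) := by
    refine (ha.inv₀ hα).congr' ?_
    filter_upwards [eventually_ne_atTop 0] with n hn
    have : (n : ℂ) ≠ 0 := by exact_mod_cast hn
    field_simp
  have h1 := Complex.tendsto_nat_mul_log_one_add_of_tendsto hg
  have h2 := (Complex.continuous_exp.tendsto _).comp (hc.mul h1)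
  rw [← div_eq_mul_inv] at h2
  have h3 : Tendsto (fun n : ℕ => 1 + (n : ℂ)⁻¹ * (a n)⁻¹) atTop (𝓝 1) := by
    simpa using (hh.mul (ha.inv₀ hα)).const_add 1
  refine h2.congr' ?_
  filter_upwards [eventually_ne_atTop 0, h3.eventually_ne one_ne_zero] with n hn hne
  have hn' : (n : ℂ) ≠ 0 := by exact_mod_cast hn
  have : (c n : ℂ) / n * (n * Complex.log (1 + (n : ℂ)⁻¹ * (a n)⁻¹)) =
      c n * Complex.log (1 + (n : ℂ)⁻¹ * (a n)⁻¹) := by field_simp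
  simp only [Function.comp]
  rw [this, Complex.exp_nat_mul, Complex.exp_log hne]

/-- The exponent `c n` grows, so the power is not expanded. With `h = 1/n` it solves `F' = -(c/n) F
/ ((a+y)(a+h+y))`, whose coefficient tends to `-γ/(α+y)²`; only the constant term needs the scalar
limit of `tendsto_one_add_inv_pow`. -/
theorem coeffTendsto_schemeInverse {a : ℕ → ℂ} {c : ℕ → ℕ} {α γ : ℂ} (hα : α ≠ 0)
    (ha : Tendsto a atTop (𝓝 α)) (hc : Tendsto (fun n => (c n : ℂ) / n) atTop (𝓝 γ)) :
    CoeffTendsto atTop (fun n => schemeInverse a (n, c n))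
      (taylorSeries (limitInverse α γ)) := by
  rw [taylorSeries_limitInverse hα]
  refine (CoeffTendsto.const _).mul ?_
  have hh : Tendsto (fun n : ℕ => (n : ℂ)⁻¹) atTop (𝓝 0) := tendsto_inv_atTop_nhds_zero_nat
  have hah : Tendsto (fun n : ℕ => a n + (n : ℂ)⁻¹) atTop (𝓝 α) := by simpa using ha.add hh
  have hw : CoeffTendsto atTop (fun n => (PowerSeries.C (a n) + PowerSeries.X)⁻¹)
      (PowerSeries.C α + PowerSeries.X)⁻¹ :=
    ((CoeffTendsto.C ha).add (CoeffTendsto.const _)).inv (by simpa using hα)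
  have hwh : CoeffTendsto atTop
      (fun n : ℕ => (PowerSeries.C (a n + (n : ℂ)⁻¹) + PowerSeries.X)⁻¹)
      (PowerSeries.C α + PowerSeries.X)⁻¹ :=
    ((CoeffTendsto.C hah).add (CoeffTendsto.const _)).inv (by simpa using hα)
  have hγ : CoeffTendsto atTop (fun n => PowerSeries.C (-((c n : ℂ) / n))) (PowerSeries.C (-γ)) :=
    CoeffTendsto.C hc.neg
  refine CoeffTendsto.of_derivative ?_ (hγ.mul (hw.mul hwh)) ?_ ?_
  · simpa [constantCoeff_taylorSeries] using tendsto_one_add_inv_pow hα ha hc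
  · filter_upwards [ha.eventually_ne hα, hah.eventually_ne hα] with n h1 h2
    have e1 : (PowerSeries.C (a n) + PowerSeries.X) * (PowerSeries.C (a n) + PowerSeries.X)⁻¹ = 1 :=
      PowerSeries.mul_inv_cancel _ (by simpa using h1)
    have e2 : (PowerSeries.C (a n + (n : ℂ)⁻¹) + PowerSeries.X) *
        (PowerSeries.C (a n + (n : ℂ)⁻¹) + PowerSeries.X)⁻¹ = 1 :=
      PowerSeries.mul_inv_cancel _ (by simpa using h2)
    have e3 : PowerSeries.C (-((c n : ℂ) / n)) = - ((c n : PowerSeries ℂ) *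
        PowerSeries.C (n : ℂ)⁻¹) := by
      rw [div_eq_mul_inv, map_neg, map_mul, map_natCast]
    rw [e3, PowerSeries.derivative_pow, map_add, Derivation.map_one_eq_zero, zero_add,
      Derivation.leibniz, PowerSeries.derivative_C, smul_zero, add_zero,
      PowerSeries.derivative_inv', map_add, PowerSeries.derivative_C, PowerSeries.derivative_X,
      zero_add, smul_eq_mul]
    rw [map_add] at e2 ⊢
    generalize (PowerSeries.C (a n) + PowerSeries.X)⁻¹ = w at *
    generalize (PowerSeries.C (a n) + PowerSeries.C (n : ℂ)⁻¹ + PowerSeries.X)⁻¹ = v at *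
    generalize PowerSeries.C (n : ℂ)⁻¹ = η at *
    have e4 : (1 + η * w) * v = w := by linear_combination w * e2 - v * e1
    -- The derivative of the power carries the truncated exponent `c n - 1`, so `c n = 0` is treated
    -- apart.
    rcases Nat.eq_zero_or_pos (c n) with h0 | h0
    · simp [h0]
    · obtain ⟨m, hm⟩ : ∃ m, c n = m + 1 := ⟨c n - 1, by omega⟩
      rw [hm]
      simp only [Nat.add_sub_cancel, pow_succ]
      linear_combination ((m + 1 : ℕ) : PowerSeries ℂ) * η * w * (1 + η * w) ^ m * e4
  · rw [derivative_taylorSeries_exp_div hα, map_neg]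
    ring

/-- The compositions tend to `X = Ψ ∘ χ` and the discrete inverses tend to `χ`, whose linear
coefficient `exp (γ/α)` is nonzero, so the composition can be undone in the limit. -/
theorem IsMomentScheme.coeffTendsto {c : ℕ → ℕ} {n₀ : ℕ} {T : ℝ} {a : ℕ → ℂ}
    {ψ : ℕ × ℕ → PowerSeries ℂ} (h : IsMomentScheme c n₀ T a ψ) {α γ : ℂ} (hα : α ≠ 0)
    (ha : Tendsto a atTop (𝓝 α)) (hc : Tendsto (fun n => (c n : ℂ) / n) atTop (𝓝 γ))
    {Ψ : PowerSeries ℂ}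
    (hΨ : seriesComp Ψ (taylorSeries (limitInverse α γ)) = PowerSeries.X) :
    CoeffTendsto atTop (fun n => ψ (n, c n)) Ψ := by
  refine CoeffTendsto.of_seriesComp (fun n => constantCoeff_schemeInverse a (n, c n))
    (by simp [constantCoeff_taylorSeries, limitInverse])
    (by rw [coeff_one_taylorSeries_limitInverse hα]; exact Complex.exp_ne_zero _)
    (coeffTendsto_schemeInverse hα ha hc) ?_
  rw [hΨ]
  intro k
  obtain ⟨K, hK⟩ := isBigO_principal.1 (h.comp_sub_X k)
  rw [tendsto_iff_norm_sub_tendsto_zero]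
  have hh : Tendsto (fun n : ℕ => K * ‖(n : ℝ)⁻¹‖) atTop (𝓝 0) := by
    simpa using (tendsto_inv_atTop_nhds_zero_nat (𝕜 := ℝ)).norm.const_mul K
  refine squeeze_zero' (Eventually.of_forall fun n => norm_nonneg _) ?_ hh
  filter_upwards [eventually_ge_atTop n₀] with n hn
  simpa using hK (n, c n) ⟨hn, le_rfl⟩

/-! ### Multiplicative Laguerre polynomials: coefficients, degree and zeros -/

theorem multiplicativeLaguerre_succ (n : ℕ) (b : ℂ) (c : ℕ) :
    multiplicativeLaguerre n b (c + 1) = X * derivative (multiplicativeLaguerre n b c) +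
      C b * multiplicativeLaguerre n b c := by
  rw [multiplicativeLaguerre, Function.iterate_succ_apply']
  rfl

theorem coeff_multiplicativeLaguerre (n : ℕ) (b : ℂ) (c j : ℕ) :
    (multiplicativeLaguerre n b c).coeff j =
      (-1 : ℂ) ^ (n - j) * (n.choose j : ℂ) * ((j : ℂ) + b) ^ c := by
  induction c with
  | zero =>
    have : (X - 1 : ℂ[X]) = X + C (-1) := by simp [sub_eq_add_neg]
    rw [multiplicativeLaguerre, Function.iterate_zero, id, this, coeff_X_add_C_pow]
    simp
  | succ c ih =>
    rw [multiplicativeLaguerre_succ, coeff_add, coeff_C_mul, ih]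
    have : (X * derivative (multiplicativeLaguerre n b c)).coeff j =
        j * (multiplicativeLaguerre n b c).coeff j := by
      cases j with
      | zero => simp
      | succ j => rw [coeff_X_mul, coeff_derivative]; push_cast; ring
    rw [this, ih]
    ring

theorem natDegree_multiplicativeLaguerre {n : ℕ} {b : ℂ} (h : (n : ℂ) + b ≠ 0) (c : ℕ) :
    (multiplicativeLaguerre n b c).natDegree = n := by
  refine natDegree_eq_of_le_of_coeff_ne_zero ?_ ?_
  · refine natDegree_le_iff_coeff_eq_zero.2 fun j hj => ?_
    rw [coeff_multiplicativeLaguerre, Nat.choose_eq_zero_of_lt hj]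
    simp
  · rw [coeff_multiplicativeLaguerre]
    simpa using pow_ne_zero c h

theorem multiplicativeLaguerre_ne_zero {n : ℕ} {b : ℂ} (h : (n : ℂ) + b ≠ 0) (c : ℕ) :
    multiplicativeLaguerre n b c ≠ 0 := by
  intro h0
  have := coeff_multiplicativeLaguerre n b c n
  rw [h0] at this
  simp only [coeff_zero, Nat.sub_self, pow_zero, Nat.choose_self, Nat.cast_one, one_mul] at this
  exact pow_ne_zero c h this.symm

/-- A zero of `x P' + b P` which is not a zero of `P`. -/
theorem sum_div_sub_add_eq_zero {P : ℂ[X]} {b z : ℂ}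
    (hz : (X * derivative P + C b * P).eval z = 0) (hPz : P.eval z ≠ 0) :
    (P.roots.map fun x => z / (z - x)).sum + b = 0 := by
  have h1 := (IsAlgClosed.splits P).eval_derivative_div_eval_of_ne_zero hPz
  have h2 : (P.roots.map fun x => z / (z - x)).sum = z * (P.roots.map fun x => 1 / (z - x)).sum := by
    rw [← Multiset.sum_map_mul_left]
    simp [div_eq_mul_inv]
  rw [h2, ← h1]
  simp only [eval_add, eval_mul, eval_X, eval_C] at hz
  field_simp
  linear_combination hz

/-- If the operator `P ↦ x P' + b P` creates no zeros outside `S`, then all the zeros of the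
multiplicative Laguerre polynomials are in `S`. -/
theorem multiplicativeLaguerre_roots_mem {n : ℕ} {b : ℂ} (h : (n : ℂ) + b ≠ 0) {S : Set ℂ}
    (h1 : (1 : ℂ) ∈ S)
    (hS : ∀ (s : Multiset ℂ) (z : ℂ), s.card = n → (∀ x ∈ s, x ∈ S) → z ∉ S →
      (s.map fun x => z / (z - x)).sum + b ≠ 0) (c : ℕ) :
    ∀ z ∈ (multiplicativeLaguerre n b c).roots, z ∈ S := by
  induction c with
  | zero =>
    intro z hz
    have : multiplicativeLaguerre n b 0 = (X - C 1) ^ n := by simp [multiplicativeLaguerre]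
    rw [this, roots_pow, roots_X_sub_C] at hz
    have := Multiset.mem_of_mem_nsmul hz
    rw [Multiset.mem_singleton.1 this]
    exact h1
  | succ c ih =>
    intro z hz
    by_contra hzS
    have hz0 := (mem_roots'.1 hz).2
    rw [multiplicativeLaguerre_succ, IsRoot.def] at hz0
    have hP := multiplicativeLaguerre_ne_zero h c
    have hPz : (multiplicativeLaguerre n b c).eval z ≠ 0 := fun h0 =>
      hzS (ih z ((mem_roots hP).2 h0))
    refine hS _ z ?_ ih hzS (sum_div_sub_add_eq_zero hz0 hPz)
    rw [← (IsAlgClosed.splits _).natDegree_eq_card_roots, natDegree_multiplicativeLaguerre h]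

/-! ### Location of the zeros on the unit circle and on the positive half-line. -/

/-- For `|x| = 1`, `Re (z/(z-x)) = 1/2 + (|z|² - 1)/(2|z-x|²)`. Adding `b` with `Re b = -n/2`
cancels the halves exactly, leaving a term that is nonzero off the circle. -/
theorem sum_div_sub_re_of_norm_eq_one (s : Multiset ℂ) (z : ℂ) (hs : ∀ x ∈ s, ‖x‖ = 1)
    (hz : ‖z‖ ≠ 1) : ∃ r : ℝ, 0 ≤ r ∧ (s ≠ 0 → 0 < r) ∧
      (s.map fun x => z / (z - x)).sum.re = s.card / 2 + (‖z‖ ^ 2 - 1) * r := by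
  induction s using Multiset.induction_on with
  | empty => exact ⟨0, le_rfl, fun h => absurd rfl h, by simp⟩
  | cons x s ih =>
    obtain ⟨r, hr, -, h⟩ := ih fun y hy => hs y (Multiset.mem_cons_of_mem hy)
    have hx := hs x (Multiset.mem_cons_self x s)
    have hne : z - x ≠ 0 := fun h0 => hz (by rw [sub_eq_zero.1 h0, hx])
    have hpos : 0 < Complex.normSq (z - x) := Complex.normSq_pos.2 hne
    refine ⟨r + (2 * Complex.normSq (z - x))⁻¹, by positivity, fun _ => by positivity, ?_⟩
    rw [Multiset.map_cons, Multiset.sum_cons, Complex.add_re, h, Multiset.card_cons]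
    have hx2 : x.re * x.re + x.im * x.im = 1 := by
      rw [← Complex.normSq_apply, Complex.normSq_eq_norm_sq, hx, one_pow]
    have hz2 : ‖z‖ ^ 2 = z.re * z.re + z.im * z.im := by
      rw [← Complex.normSq_apply, Complex.normSq_eq_norm_sq]
    have key : (z / (z - x)).re = 1 / 2 + (‖z‖ ^ 2 - 1) * (2 * Complex.normSq (z - x))⁻¹ := by
      rw [Complex.div_re, hz2]
      field_simp
      rw [Complex.normSq_apply]
      simp only [Complex.sub_re, Complex.sub_im]
      linear_combination (-1 : ℝ) * hx2
    rw [key]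
    push_cast
    ring

/-- For real `t > 0`, `Im (z/(z-t)) = -t Im z/|z-t|²`: all terms have the same sign, so no real `b`
can cancel their sum. -/
theorem sum_div_sub_im_of_pos (s : Multiset ℂ) (z : ℂ)
    (hs : ∀ x ∈ s, ∃ r : ℝ, 0 < r ∧ x = r) (hz : z.im ≠ 0) :
    ∃ r : ℝ, 0 ≤ r ∧ (s ≠ 0 → 0 < r) ∧
      (s.map fun x => z / (z - x)).sum.im = - z.im * r := by
  induction s using Multiset.induction_on with
  | empty => exact ⟨0, le_rfl, fun h => absurd rfl h, by simp⟩
  | cons x s ih =>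
    obtain ⟨r, hr, -, h⟩ := ih fun y hy => hs y (Multiset.mem_cons_of_mem hy)
    obtain ⟨t, ht, rfl⟩ := hs _ (Multiset.mem_cons_self x s)
    have hne : z - t ≠ 0 := fun h0 => hz (by rw [sub_eq_zero.1 h0, Complex.ofReal_im])
    have hpos : 0 < Complex.normSq (z - t) := Complex.normSq_pos.2 hne
    refine ⟨r + t * (Complex.normSq (z - t))⁻¹, by positivity, fun _ => by positivity, ?_⟩
    rw [Multiset.map_cons, Multiset.sum_cons, Complex.add_im, h]
    have key : (z / (z - t)).im = - z.im * (t * (Complex.normSq (z - t))⁻¹) := by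
      rw [Complex.div_im]
      field_simp
      simp only [Complex.sub_re, Complex.sub_im, Complex.ofReal_re, Complex.ofReal_im]
      ring
    rw [key]
    ring

/-- Each summand lies in `[0, 1]`, so a zero at `t ≤ 0` would force `b ∈ [-n, 0]`. -/
theorem sum_div_sub_re_of_nonpos (s : Multiset ℂ) {t : ℝ}
    (hs : ∀ x ∈ s, ∃ r : ℝ, 0 < r ∧ x = r) (ht : t ≤ 0) :
    0 ≤ (s.map fun x => (t : ℂ) / (t - x)).sum.re ∧
      (s.map fun x => (t : ℂ) / (t - x)).sum.re ≤ s.card := by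
  induction s using Multiset.induction_on with
  | empty => simp
  | cons x s ih =>
    obtain ⟨h1, h2⟩ := ih fun y hy => hs y (Multiset.mem_cons_of_mem hy)
    obtain ⟨r, hr, rfl⟩ := hs _ (Multiset.mem_cons_self x s)
    rw [Multiset.map_cons, Multiset.sum_cons, Complex.add_re, Multiset.card_cons]
    have key : ((t : ℂ) / (t - r)).re = t / (t - r) := by
      rw [← Complex.ofReal_sub, ← Complex.ofReal_div, Complex.ofReal_re]
    have h3 : 0 ≤ t / (t - r) := div_nonneg_of_nonpos ht (by linarith)
    have h4 : t / (t - r) ≤ 1 := by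
      rw [div_le_one_of_neg (by linarith)]
      linarith
    rw [key]
    push_cast
    constructor <;> linarith

theorem multiplicativeLaguerre_roots_norm {n : ℕ} {b : ℂ} (hn : 1 ≤ n)
    (hb : b.re = -(n : ℝ) / 2) (c : ℕ) :
    ∀ z ∈ (multiplicativeLaguerre n b c).roots, z ∈ Metric.sphere (0 : ℂ) 1 := by
  have hn' : (0 : ℝ) < n := by exact_mod_cast hn
  refine multiplicativeLaguerre_roots_mem ?_ (by simp) ?_ c
  · intro h
    have := congrArg Complex.re h
    simp [hb] at this
    linarith
  · intro s z hs hsS hz h0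
    simp only [mem_sphere_zero_iff_norm] at hsS hz
    obtain ⟨r, -, hr, h⟩ := sum_div_sub_re_of_norm_eq_one s z hsS hz
    have hr' := hr (by rintro rfl; simp at hs; omega)
    have := congrArg Complex.re h0
    rw [Complex.add_re, h, hb, hs, Complex.zero_re] at this
    have h1 : (‖z‖ ^ 2 - 1) * r = 0 := by linarith
    rcases mul_eq_zero.1 h1 with h2 | h2
    · have h3 : ‖z‖ ^ 2 = 1 := by linarith
      exact hz ((pow_eq_one_iff_of_nonneg (norm_nonneg z) two_ne_zero).1 h3)
    · exact hr'.ne' h2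

theorem natCast_add_ofReal_ne_zero {n : ℕ} {x : ℝ} (hx : x ∉ Set.Icc (-(n : ℝ)) 0) :
    (n : ℂ) + x ≠ 0 := by
  intro h
  have h1 : (n : ℝ) + x = 0 := by exact_mod_cast h
  have hn : (0 : ℝ) ≤ n := n.cast_nonneg
  exact hx ⟨by linarith, by linarith⟩

theorem multiplicativeLaguerre_roots_pos {n : ℕ} {x : ℝ} (hn : 1 ≤ n)
    (hx : x ∉ Set.Icc (-(n : ℝ)) 0) (c : ℕ) :
    ∀ z ∈ (multiplicativeLaguerre n x c).roots, z ∈ {z : ℂ | ∃ r : ℝ, 0 < r ∧ z = r} := by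
  refine multiplicativeLaguerre_roots_mem (S := {z : ℂ | ∃ r : ℝ, 0 < r ∧ z = r})
    (natCast_add_ofReal_ne_zero hx) ⟨1, one_pos, by simp⟩ ?_ c
  intro s z hs hsS hz h0
  by_cases him : z.im = 0
  · obtain ⟨t, rfl⟩ : ∃ t : ℝ, z = t := ⟨z.re, by apply Complex.ext <;> simp [him]⟩
    have ht : t ≤ 0 := by
      by_contra ht
      exact hz ⟨t, not_le.1 ht, rfl⟩
    obtain ⟨h1, h2⟩ := sum_div_sub_re_of_nonpos s hsS ht
    have := congrArg Complex.re h0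
    rw [Complex.add_re, Complex.ofReal_re, Complex.zero_re] at this
    rw [hs] at h2
    exact hx ⟨by linarith, by linarith⟩
  · obtain ⟨r, -, hr, h⟩ := sum_div_sub_im_of_pos s z hsS him
    have hr' := hr (by rintro rfl; simp at hs; omega)
    have := congrArg Complex.im h0
    rw [Complex.add_im, h, Complex.ofReal_im, Complex.zero_im, add_zero] at this
    rcases mul_eq_zero.1 this with h2 | h2
    · exact him (by linarith)
    · exact hr'.ne' h2

/-! ### The moment series of multiplicative Laguerre polynomials -/

/-- The reversed multiplicative Laguerre polynomial, as a power series. -/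
noncomputable def reversedLaguerre (n : ℕ) (b : ℂ) (c : ℕ) : PowerSeries ℂ :=
  PowerSeries.mk fun k => (-1 : ℂ) ^ k * (n.choose k : ℂ) * ((n : ℂ) - k + b) ^ c

theorem reversedLaguerre_succ (n : ℕ) (b : ℂ) (c : ℕ) :
    reversedLaguerre n b (c + 1) = PowerSeries.C ((n : ℂ) + b) * reversedLaguerre n b c -
      eulerDeriv (reversedLaguerre n b c) := by
  ext k
  simp only [map_sub, PowerSeries.coeff_C_mul, coeff_eulerDeriv, reversedLaguerre,
    PowerSeries.coeff_mk]
  ring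

theorem constantCoeff_reversedLaguerre (n : ℕ) (b : ℂ) (c : ℕ) :
    PowerSeries.constantCoeff (reversedLaguerre n b c) = ((n : ℂ) + b) ^ c := by
  rw [← PowerSeries.coeff_zero_eq_constantCoeff_apply, reversedLaguerre, PowerSeries.coeff_mk]
  simp

/-- The logarithmic derivative of `(1 - t)^n`, cleared of denominators; it provides the initial
value of the scheme. -/
theorem eulerDeriv_reversedLaguerre_zero (n : ℕ) (b : ℂ) :
    eulerDeriv (reversedLaguerre n b 0) * (1 - PowerSeries.X) =
      - (PowerSeries.C (n : ℂ) * (PowerSeries.X * reversedLaguerre n b 0)) := by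
  ext k
  rw [mul_sub, mul_one, map_sub, map_neg, PowerSeries.coeff_C_mul, mul_comm _ PowerSeries.X]
  cases k with
  | zero => simp [coeff_eulerDeriv]
  | succ k =>
    rw [PowerSeries.coeff_succ_X_mul, PowerSeries.coeff_succ_X_mul, coeff_eulerDeriv,
      coeff_eulerDeriv]
    simp only [reversedLaguerre, PowerSeries.coeff_mk, pow_zero, mul_one]
    have h : (n.choose (k + 1) : ℂ) * ((k : ℂ) + 1) = n.choose k * ((n : ℂ) - k) := by
      rcases Nat.lt_or_ge n k with hk | hk
      · simp [Nat.choose_eq_zero_of_lt hk, Nat.choose_eq_zero_of_lt (hk.trans (Nat.lt_succ_self k))]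
      · have := Nat.choose_succ_right_eq n k
        rw [← Nat.cast_sub hk]
        exact_mod_cast this
    push_cast
    rw [pow_succ]
    linear_combination (-(-1 : ℂ) ^ k) * h

/-- The moment series `- (1 / n) t Q' / Q` of the reversed multiplicative Laguerre polynomial. -/
noncomputable def laguerreMomentSeries (b : ℕ → ℂ) (i : ℕ × ℕ) : PowerSeries ℂ :=
  - (PowerSeries.C (i.1 : ℂ)⁻¹ * (eulerDeriv (reversedLaguerre i.1 (b i.1) i.2) *
    (reversedLaguerre i.1 (b i.1) i.2)⁻¹))

theorem laguerreMomentSeries_mul {n : ℕ} {b : ℕ → ℂ} (h : (n : ℂ) + b n ≠ 0) (hn : n ≠ 0) (j : ℕ) :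
    PowerSeries.C (n : ℂ) * (laguerreMomentSeries b (n, j) * reversedLaguerre n (b n) j) =
      - eulerDeriv (reversedLaguerre n (b n) j) := by
  have h1 : (reversedLaguerre n (b n) j)⁻¹ * reversedLaguerre n (b n) j = 1 :=
    PowerSeries.inv_mul_cancel _ (by
      rw [constantCoeff_reversedLaguerre]; exact pow_ne_zero j h)
  have h2 : (PowerSeries.C (n : ℂ) * PowerSeries.C (n : ℂ)⁻¹ : PowerSeries ℂ) = 1 := by
    rw [← map_mul, mul_inv_cancel₀ (by exact_mod_cast hn), map_one]
  simp only [laguerreMomentSeries]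
  linear_combination (- PowerSeries.C (n : ℂ) * PowerSeries.C (n : ℂ)⁻¹ *
    eulerDeriv (reversedLaguerre n (b n) j)) * h1 -
    eulerDeriv (reversedLaguerre n (b n) j) * h2

theorem isMomentScheme_laguerre {b : ℕ → ℂ} {c : ℕ → ℕ} {β : ℂ} {γ : ℝ}
    (hβ : β + 1 ≠ 0) (hne : ∀ n : ℕ, 1 ≤ n → (n : ℂ) + b n ≠ 0)
    (hb : Tendsto (fun n : ℕ => b n / (n : ℂ)) atTop (𝓝 β))
    (hc : Tendsto (fun n : ℕ => (c n : ℝ) / (n : ℝ)) atTop (𝓝 γ)) :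
    ∃ (n₀ : ℕ) (T : ℝ),
      IsMomentScheme c n₀ T (fun n => b n / (n : ℂ) + 1) (laguerreMomentSeries b) := by
  have ha : Tendsto (fun n : ℕ => b n / (n : ℂ) + 1) atTop (𝓝 (β + 1)) := hb.add_const 1
  have h1 := ha.norm.eventually_le_const (lt_add_one _)
  have h2 := (ha.inv₀ hβ).norm.eventually_le_const (lt_add_one _)
  have h3 := ha.eventually_ne hβ
  have h4 := hc.eventually_le_const (lt_add_one γ)
  -- Beyond `n₀` the numbers `a n = b n / n + 1` are bounded and bounded away from zero, because `β
  -- + 1 ≠ 0`, and `c n / n ≤ γ + 1`.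
  obtain ⟨n₀, h⟩ := eventually_atTop.1 (((h1.and h2).and (h3.and h4)).and (eventually_ge_atTop 1))
  refine ⟨n₀, γ + 1, ?_⟩
  have hpos : ∀ n ≥ n₀, 1 ≤ n := fun n hn => (h n hn).2
  have hcoe : ∀ n ≥ n₀, (n : ℂ) ≠ 0 := fun n hn => by
    have := hpos n hn
    exact_mod_cast (by omega : n ≠ 0)
  have hQ : ∀ n ≥ n₀, ∀ j, PowerSeries.constantCoeff (reversedLaguerre n (b n) j) ≠ 0 := by
    intro n hn j
    rw [constantCoeff_reversedLaguerre]
    exact pow_ne_zero j (hne n (hpos n hn))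
  have hQ0 : ∀ n ≥ n₀, ∀ j, reversedLaguerre n (b n) j ≠ 0 := fun n hn j h0 =>
    hQ n hn j (by rw [h0, map_zero])
  have hCn : ∀ n ≥ n₀, (PowerSeries.C (n : ℂ) * PowerSeries.C (n : ℂ)⁻¹ : PowerSeries ℂ) = 1 := by
    intro n hn
    rw [← map_mul, mul_inv_cancel₀ (hcoe n hn), map_one]
  have hCn0 : ∀ n ≥ n₀, (PowerSeries.C (n : ℂ) : PowerSeries ℂ) ≠ 0 := by
    intro n hn h0
    have := hCn n hn
    rw [h0, zero_mul] at this
    exact zero_ne_one this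
  have hmul := fun (n : ℕ) (hn : n ≥ n₀) (j : ℕ) =>
    laguerreMomentSeries_mul (hne n (hpos n hn)) (Nat.one_le_iff_ne_zero.1 (hpos n hn)) j
  refine ⟨hpos n₀ le_rfl, fun n hn => ?_, ⟨_, fun n hn => (h n hn).1.1.1⟩,
    ⟨_, fun n hn => (h n hn).1.1.2⟩, fun n hn => (h n hn).1.2.1, fun n hn => ?_,
    fun n hn j _ => ?_⟩
  · have hn' : (0 : ℝ) < n := by exact_mod_cast hpos n hn
    exact (div_le_iff₀ hn').1 (h n hn).1.2.2
  · have e1 := hmul n hn 0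
    have e2 := eulerDeriv_reversedLaguerre_zero n (b n)
    have e3 : (1 - PowerSeries.X : PowerSeries ℂ) * (1 - PowerSeries.X)⁻¹ = 1 :=
      PowerSeries.mul_inv_cancel _ (by simp)
    refine mul_left_cancel₀ (hCn0 n hn) (mul_right_cancel₀ (hQ0 n hn 0) ?_)
    generalize eulerDeriv (reversedLaguerre n (b n) 0) = D at *
    generalize reversedLaguerre n (b n) 0 = Q at *
    linear_combination e1 - (1 - PowerSeries.X)⁻¹ * e2 + (D - PowerSeries.C (n : ℂ) * Q) * e3
  · have e1 := hmul n hn j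
    have e2 := hmul n hn (j + 1)
    have e3 := reversedLaguerre_succ n (b n) j
    set Q := reversedLaguerre n (b n) j with hQdef
    set ψ := laguerreMomentSeries b (n, j) with hψ
    have ha' : PowerSeries.constantCoeff (PowerSeries.C (b n / (n : ℂ) + 1) + ψ) ≠ 0 := by
      simpa [hψ, laguerreMomentSeries, constantCoeff_eulerDeriv] using (h n hn).1.2.1
    have e4 : (PowerSeries.C (b n / (n : ℂ) + 1) + ψ) *
      (PowerSeries.C (b n / (n : ℂ) + 1) + ψ)⁻¹ = 1 := PowerSeries.mul_inv_cancel _ ha'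
    have e5 : PowerSeries.C ((n : ℂ) + b n) =
        (PowerSeries.C (n : ℂ) * PowerSeries.C (b n / (n : ℂ) + 1) : PowerSeries ℂ) := by
      rw [← map_mul]
      congr 1
      field_simp [hcoe n hn]
      ring
    -- The recursion in multiplicative form `Q_{j+1} = n (a + ψ_j) Q_j`; its logarithmic derivative
    -- is the Euler step.
    have e6 : reversedLaguerre n (b n) (j + 1) =
        PowerSeries.C (n : ℂ) * ((PowerSeries.C (b n / (n : ℂ) + 1) + ψ) * Q) := by
      rw [e3, e5]; linear_combination -e1
    have e7 : eulerDeriv (reversedLaguerre n (b n) (j + 1)) = PowerSeries.C (n : ℂ) *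
        (eulerDeriv ψ * Q + (PowerSeries.C (b n / (n : ℂ) + 1) + ψ) * eulerDeriv Q) := by
      rw [e6, eulerDeriv_mul, eulerDeriv_mul, eulerDeriv_add, eulerDeriv_C, eulerDeriv_C]
      ring
    have hne' := hQ0 n hn (j + 1)
    refine mul_left_cancel₀ (hCn0 n hn) (mul_right_cancel₀ hne' ?_)
    rw [mul_assoc, e2, e7, e6]
    have e8 := hCn n hn
    generalize (PowerSeries.C (b n / (n : ℂ) + 1) + ψ)⁻¹ = v at *
    generalize PowerSeries.C (b n / (n : ℂ) + 1) + ψ = u at *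
    generalize eulerDeriv Q = D at *
    generalize eulerDeriv ψ = E at *
    generalize PowerSeries.C (n : ℂ)⁻¹ = η at *
    generalize PowerSeries.C (n : ℂ) = N at *
    linear_combination (-N * u) * e1 + (N * E * Q * N * η) * e4 + N * E * Q * e8

/-! ### Moments of zero distributions -/

theorem integral_sum_dirac {E : Type*} [NormedAddCommGroup E] [NormedSpace ℝ E] [CompleteSpace E]
    (s : Multiset ℂ) (f : ℂ → E) :
    Integrable f (s.map fun z => Measure.dirac z).sum ∧
      ∫ x, f x ∂(s.map fun z => Measure.dirac z).sum = (s.map f).sum := by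
  induction s using Multiset.induction_on with
  | empty => simp
  | cons z s ih =>
    rw [Multiset.map_cons, Multiset.sum_cons, Multiset.map_cons, Multiset.sum_cons]
    have hz : Integrable f (Measure.dirac z) := integrable_dirac (by simp)
    exact ⟨hz.add_measure ih.1, by rw [integral_add_measure hz ih.1, ih.2, integral_dirac]⟩

theorem coe_zeroDistribution {P : ℂ[X]} (hP : P.natDegree ≠ 0) :
    (zeroDistribution P : Measure ℂ) = zeroCountingMeasure P := by
  have : zeroDistribution P = ⟨zeroCountingMeasure P,
      zeroCountingMeasure_isProbabilityMeasure P hP⟩ := dif_pos hP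
  rw [this]
  rfl

theorem integrable_zeroDistribution {E : Type*} [NormedAddCommGroup E] [NormedSpace ℝ E]
    [CompleteSpace E] {P : ℂ[X]} (hP : P.natDegree ≠ 0) (f : ℂ → E) :
    Integrable f (zeroDistribution P : Measure ℂ) := by
  rw [coe_zeroDistribution hP, zeroCountingMeasure]
  exact (integral_sum_dirac P.roots f).1.smul_measure
    (ENNReal.inv_ne_top.2 (by exact_mod_cast hP))

theorem integral_zeroDistribution {E : Type*} [NormedAddCommGroup E] [NormedSpace ℝ E]
    [CompleteSpace E] {P : ℂ[X]} (hP : P.natDegree ≠ 0) (f : ℂ → E) :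
    ∫ x, f x ∂(zeroDistribution P : Measure ℂ) = (P.natDegree : ℝ)⁻¹ • (P.roots.map f).sum := by
  rw [coe_zeroDistribution hP, zeroCountingMeasure, integral_smul_measure,
    (integral_sum_dirac P.roots f).2]
  simp

theorem zeroDistribution_compl_eq_zero {P : ℂ[X]} (hP : P.natDegree ≠ 0) {S : Set ℂ}
    (hS : MeasurableSet S) (h : ∀ z ∈ P.roots, z ∈ S) :
    (zeroDistribution P : Measure ℂ) Sᶜ = 0 := by
  rw [coe_zeroDistribution hP, zeroCountingMeasure, Measure.smul_apply]
  have : ∀ s : Multiset ℂ, (∀ z ∈ s, z ∈ S) →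
      (s.map fun z => Measure.dirac z).sum Sᶜ = 0 := by
    intro s
    induction s using Multiset.induction_on with
    | empty => simp
    | cons z s ih =>
      intro hs
      rw [Multiset.map_cons, Multiset.sum_cons, Measure.add_apply,
        ih fun y hy => hs y (Multiset.mem_cons_of_mem hy), Measure.dirac_apply' _ hS.compl]
      simp [hs z (Multiset.mem_cons_self z s)]
  rw [this _ h, smul_zero]

/-- Newton's identities as a generating function: the logarithmic Euler derivative of `∏ (1 - z t)`
is `-∑ z t/(1 - z t)`, whose coefficients are power sums. The term `k = 0` is removed since `z t/(1
- z t)` has no constant term. -/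
theorem eulerDeriv_prod_one_sub (s : Multiset ℂ) :
    eulerDeriv (s.map fun z => (1 - PowerSeries.C z * PowerSeries.X : PowerSeries ℂ)).prod =
      - ((s.map fun z => (1 - PowerSeries.C z * PowerSeries.X : PowerSeries ℂ)).prod *
        (s.map fun z => PowerSeries.mk fun k => if k = 0 then 0 else z ^ k).sum) := by
  induction s using Multiset.induction_on with
  | empty => simpa using eulerDeriv_C 1
  | cons z s ih =>
    rw [Multiset.map_cons, Multiset.prod_cons, Multiset.map_cons, Multiset.sum_cons,
      eulerDeriv_mul, ih]
    have h1 : eulerDeriv (1 - PowerSeries.C z * PowerSeries.X) =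
        - (PowerSeries.C z * PowerSeries.X) := by
      rw [eulerDeriv_sub, eulerDeriv_mul, eulerDeriv_C]
      have : eulerDeriv 1 = 0 := by simpa using eulerDeriv_C 1
      rw [this]
      simp [eulerDeriv]
    have h2 : (1 - PowerSeries.C z * PowerSeries.X) *
        (PowerSeries.mk fun k => if k = 0 then 0 else z ^ k) = PowerSeries.C z * PowerSeries.X := by
      ext k
      rw [sub_mul, one_mul, map_sub, mul_assoc, PowerSeries.coeff_C_mul, PowerSeries.coeff_C_mul]
      rcases k with _ | _ | k
      · simp
      · rw [PowerSeries.coeff_succ_X_mul]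
        simp
      · rw [PowerSeries.coeff_succ_X_mul]
        simp [PowerSeries.coeff_X, pow_succ]
        ring
    rw [h1]
    linear_combination ((s.map fun z =>
      (1 - PowerSeries.C z * PowerSeries.X : PowerSeries ℂ)).prod) * h2

/-- Reversal is multiplicative over a domain and sends `X - z` to `1 - z t`, even for `z = 0`, where
the degree drops. -/
theorem reverse_multiset_prod (s : Multiset ℂ) :
    (((s.map fun z => (X - C z : ℂ[X])).prod.reverse : ℂ[X]) : PowerSeries ℂ) =
      (s.map fun z => (1 - PowerSeries.C z * PowerSeries.X : PowerSeries ℂ)).prod := by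
  induction s using Multiset.induction_on with
  | empty =>
    have : (1 : ℂ[X]).reverse = 1 := by simpa using reverse_C (1 : ℂ)
    simp [this]
  | cons z s ih =>
    rw [Multiset.map_cons, Multiset.prod_cons, Multiset.map_cons, Multiset.prod_cons,
      reverse_mul_of_domain, Polynomial.coe_mul, ih]
    congr 1
    have : (X - C z : ℂ[X]).reverse = 1 - C z * X := by
      ext k
      rw [coeff_reverse, natDegree_X_sub_C]
      rcases k with _ | _ | k
      · simp
      · simp [coeff_one, coeff_X]
      · rw [revAt_eq_self_of_lt (by omega)]
        simp [coeff_one, coeff_X]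
    rw [this]
    simp

theorem coe_reverse_multiplicativeLaguerre {n : ℕ} {b : ℂ} (h : (n : ℂ) + b ≠ 0) (c : ℕ) :
    ((multiplicativeLaguerre n b c).reverse : PowerSeries ℂ) = reversedLaguerre n b c := by
  ext k
  rw [Polynomial.coeff_coe, coeff_reverse, natDegree_multiplicativeLaguerre h,
    coeff_multiplicativeLaguerre, reversedLaguerre, PowerSeries.coeff_mk]
  rcases Nat.lt_or_ge n k with hk | hk
  · rw [revAt_eq_self_of_lt hk, Nat.choose_eq_zero_of_lt hk]
    simp
  · rw [revAt_le hk, Nat.sub_sub_self hk, Nat.choose_symm hk, Nat.cast_sub hk]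

theorem reversedLaguerre_eq_prod {n : ℕ} {b : ℂ} (h : (n : ℂ) + b ≠ 0) (c : ℕ) :
    reversedLaguerre n b c = PowerSeries.C (multiplicativeLaguerre n b c).leadingCoeff *
      ((multiplicativeLaguerre n b c).roots.map fun z =>
        (1 - PowerSeries.C z * PowerSeries.X : PowerSeries ℂ)).prod := by
  rw [← coe_reverse_multiplicativeLaguerre h]
  conv_lhs => rw [(IsAlgClosed.splits (multiplicativeLaguerre n b c)).eq_prod_roots]
  rw [reverse_mul_of_domain, reverse_C, Polynomial.coe_mul, Polynomial.coe_C,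
    reverse_multiset_prod]

theorem analyticMoment_laguerre {n : ℕ} {b : ℕ → ℂ} (h : (n : ℂ) + b n ≠ 0) (hn : n ≠ 0) (c : ℕ)
    {k : ℕ} (hk : k ≠ 0) :
    analyticMoment (zeroDistribution (multiplicativeLaguerre n (b n) c) : Measure ℂ) k =
      PowerSeries.coeff k (laguerreMomentSeries b (n, c)) := by
  have hd := natDegree_multiplicativeLaguerre h c
  have e1 := laguerreMomentSeries_mul h hn c
  have e2 := reversedLaguerre_eq_prod h c
  have e3 := eulerDeriv_prod_one_sub (multiplicativeLaguerre n (b n) c).roots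
  have hQ : PowerSeries.constantCoeff (reversedLaguerre n (b n) c) ≠ 0 := by
    rw [constantCoeff_reversedLaguerre]
    exact pow_ne_zero c h
  have hQ0 : reversedLaguerre n (b n) c ≠ 0 := fun h0 => hQ (by rw [h0, map_zero])
  have e4 : PowerSeries.C (n : ℂ) * laguerreMomentSeries b (n, c) =
      ((multiplicativeLaguerre n (b n) c).roots.map
        fun z => PowerSeries.mk fun k => if k = 0 then 0 else z ^ k).sum := by
    refine mul_right_cancel₀ hQ0 ?_
    rw [mul_assoc, e1]
    conv_lhs => rw [e2, eulerDeriv_mul, eulerDeriv_C, e3]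
    conv_rhs => rw [e2]
    ring
  have e5 := congrArg (PowerSeries.coeff k) e4
  rw [PowerSeries.coeff_C_mul, map_multiset_sum, Multiset.map_map] at e5
  have e6 : (PowerSeries.coeff k : PowerSeries ℂ →ₗ[ℂ] ℂ) ∘
      (fun z : ℂ => PowerSeries.mk fun k => if k = 0 then 0 else z ^ k) = fun z => z ^ k := by
    ext z
    simp [hk]
  rw [e6] at e5
  rw [analyticMoment, integral_zeroDistribution (by rw [hd]; exact hn), hd, ← e5]
  have hn' : (n : ℂ) ≠ 0 := by exact_mod_cast hn
  rw [Complex.real_smul]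
  push_cast
  field_simp

/-! ### Weak convergence from convergence of moments -/

theorem measure_norm_gt_le {μ : Measure ℂ} [IsFiniteMeasure μ] {k : ℕ} {C r : ℝ} (hr : 0 < r)
    (hi : Integrable (fun z : ℂ => ‖z‖ ^ k) μ) (hC : ∫ z, ‖z‖ ^ k ∂μ ≤ C) :
    μ {z | r < ‖z‖} ≤ ENNReal.ofReal (C / r ^ k) := by
  have h1 := mul_meas_ge_le_integral_of_nonneg (μ := μ) (f := fun z : ℂ => ‖z‖ ^ k)
    (Eventually.of_forall fun z => by positivity) hi (r ^ k)
  have h2 : μ.real {z | r ^ k ≤ ‖z‖ ^ k} ≤ C / r ^ k := by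
    rw [le_div_iff₀' (by positivity)]
    exact h1.trans hC
  calc μ {z | r < ‖z‖} ≤ μ {z | r ^ k ≤ ‖z‖ ^ k} :=
        measure_mono fun z (hz : r < ‖z‖) => pow_le_pow_left₀ hr.le hz.le k
    _ = ENNReal.ofReal (μ.real {z | r ^ k ≤ ‖z‖ ^ k}) :=
        (ENNReal.ofReal_toReal (measure_ne_top _ _)).symm
    _ ≤ _ := ENNReal.ofReal_le_ofReal h2

/-- Fatou's inequality for weak convergence: portmanteau on open sets gives lower semicontinuity of
integrals of nonnegative continuous functions, bounded or not. -/
theorem integrable_norm_pow_of_tendsto {μ : ℕ → ProbabilityMeasure ℂ} {ν : ProbabilityMeasure ℂ}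
    (h : Tendsto μ atTop (𝓝 ν)) {k : ℕ} {C : ℝ}
    (hC : ∀ᶠ n in atTop, Integrable (fun z : ℂ => ‖z‖ ^ k) (μ n : Measure ℂ) ∧
      ∫ z, ‖z‖ ^ k ∂(μ n : Measure ℂ) ≤ C) :
    Integrable (fun z : ℂ => ‖z‖ ^ k) (ν : Measure ℂ) ∧ ∫ z, ‖z‖ ^ k ∂(ν : Measure ℂ) ≤ C := by
  have hcont : Continuous fun z : ℂ => ‖z‖ ^ k := by fun_prop
  have hnn : (0 : ℂ → ℝ) ≤ fun z : ℂ => ‖z‖ ^ k := fun z => by positivity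
  obtain ⟨n, hn⟩ := hC.exists
  have hC0 : 0 ≤ C := (integral_nonneg hnn).trans hn.2
  have h1 := lintegral_le_liminf_lintegral_of_forall_isOpen_measure_le_liminf_measure
    (μ := (ν : Measure ℂ)) (μs := fun n => (μ n : Measure ℂ)) hcont hnn
    fun G hG => ProbabilityMeasure.le_liminf_measure_open_of_tendsto h hG
  have h2 : ∫⁻ z, ENNReal.ofReal (‖z‖ ^ k) ∂(ν : Measure ℂ) ≤ ENNReal.ofReal C := by
    refine h1.trans (liminf_le_of_frequently_le' (Eventually.frequently ?_))
    filter_upwards [hC] with n hn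
    rw [← ofReal_integral_eq_lintegral_ofReal hn.1 (Eventually.of_forall hnn)]
    exact ENNReal.ofReal_le_ofReal hn.2
  have h3 : Integrable (fun z : ℂ => ‖z‖ ^ k) (ν : Measure ℂ) := by
    refine ⟨hcont.aestronglyMeasurable, ?_⟩
    rw [hasFiniteIntegral_iff_ofReal (Eventually.of_forall hnn)]
    exact h2.trans_lt ENNReal.ofReal_lt_top
  refine ⟨h3, ?_⟩
  rw [← ofReal_integral_eq_lintegral_ofReal h3 (Eventually.of_forall hnn)] at h2
  exact (ENNReal.ofReal_le_ofReal_iff hC0).1 h2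

/-- A continuous cutoff of the monomial `z ^ k` to the disc of radius `T + 1`. -/
noncomputable def cutoffPow (k : ℕ) (T : ℝ) (hT : 0 ≤ T) : BoundedContinuousFunction ℂ ℂ :=
  BoundedContinuousFunction.ofNormedAddCommGroup
    (fun z => ((max 0 (min 1 (T + 1 - ‖z‖)) : ℝ) : ℂ) * z ^ k) (by fun_prop) ((T + 1) ^ k) (by
      intro z
      rw [norm_mul, Complex.norm_real, Real.norm_of_nonneg (le_max_left _ _), norm_pow]
      rcases le_or_gt (T + 1) ‖z‖ with h | h
      · rw [max_eq_left ((min_le_right _ _).trans (by linarith)), zero_mul]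
        positivity
      · calc _ ≤ 1 * ‖z‖ ^ k :=
              mul_le_mul_of_nonneg_right (max_le zero_le_one (min_le_left _ _)) (by positivity)
          _ ≤ _ := by
              rw [one_mul]
              exact pow_le_pow_left₀ (norm_nonneg z) h.le k)

theorem integrable_pow_of_norm {μ : Measure ℂ} {k : ℕ}
    (h : Integrable (fun z : ℂ => ‖z‖ ^ k) μ) : Integrable (fun z : ℂ => z ^ k) μ :=
  h.mono' (by fun_prop) (Eventually.of_forall fun z => by simp)

/-- The cutoff changes `z ^ k` only where `‖z‖ > T`, and there `‖z‖ ^ k ≤ ‖z‖ ^ (k+1) / T`; one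
extra moment makes the truncation error uniform. -/
theorem norm_analyticMoment_sub_cutoffPow_le {μ : Measure ℂ} [IsFiniteMeasure μ] {k : ℕ} {C T : ℝ}
    (hT : 0 < T) (h0 : Integrable (fun z : ℂ => ‖z‖ ^ k) μ)
    (h1 : Integrable (fun z : ℂ => ‖z‖ ^ (k + 1)) μ) (hC : ∫ z, ‖z‖ ^ (k + 1) ∂μ ≤ C) :
    ‖analyticMoment μ k - ∫ z, cutoffPow k T hT.le z ∂μ‖ ≤ C / T := by
  rw [analyticMoment, ← integral_sub (integrable_pow_of_norm h0)
    ((cutoffPow k T hT.le).integrable μ)]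
  have : ∀ z : ℂ, ‖z ^ k - cutoffPow k T hT.le z‖ ≤ ‖z‖ ^ (k + 1) / T := by
    intro z
    have e : cutoffPow k T hT.le z = ((max 0 (min 1 (T + 1 - ‖z‖)) : ℝ) : ℂ) * z ^ k := rfl
    have e2 : z ^ k - ((max 0 (min 1 (T + 1 - ‖z‖)) : ℝ) : ℂ) * z ^ k =
        ((1 - max 0 (min 1 (T + 1 - ‖z‖)) : ℝ) : ℂ) * z ^ k := by push_cast; ring
    have h3 : max 0 (min 1 (T + 1 - ‖z‖)) ≤ 1 := max_le zero_le_one (min_le_left _ _)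
    rw [e, e2, norm_mul, Complex.norm_real, Real.norm_of_nonneg (by linarith), norm_pow]
    rcases le_or_gt ‖z‖ T with h | h
    · rw [min_eq_left (by linarith), max_eq_right zero_le_one, sub_self, zero_mul]
      positivity
    · rw [le_div_iff₀ hT, pow_succ]
      have h4 : (1 - max 0 (min 1 (T + 1 - ‖z‖))) ≤ 1 := by
        linarith [le_max_left 0 (min 1 (T + 1 - ‖z‖))]
      calc (1 - max 0 (min 1 (T + 1 - ‖z‖))) * ‖z‖ ^ k * T ≤ 1 * ‖z‖ ^ k * ‖z‖ := by
            gcongr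
        _ = _ := by ring
  calc _ ≤ ∫ z, ‖z‖ ^ (k + 1) / T ∂μ :=
        norm_integral_le_of_norm_le (h1.div_const T) (Eventually.of_forall this)
    _ = (∫ z, ‖z‖ ^ (k + 1) ∂μ) / T := integral_div _ _
    _ ≤ _ := by gcongr

theorem tendsto_analyticMoment {μ : ℕ → ProbabilityMeasure ℂ} {ν : ProbabilityMeasure ℂ}
    (h : Tendsto μ atTop (𝓝 ν))
    (hC : ∀ k, ∃ C : ℝ, ∀ᶠ n in atTop, Integrable (fun z : ℂ => ‖z‖ ^ k) (μ n : Measure ℂ) ∧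
      ∫ z, ‖z‖ ^ k ∂(μ n : Measure ℂ) ≤ C) (k : ℕ) :
    Tendsto (fun n => analyticMoment (μ n : Measure ℂ) k) atTop
      (𝓝 (analyticMoment (ν : Measure ℂ) k)) := by
  obtain ⟨C₀, hC₀⟩ := hC k
  obtain ⟨C₁, hC₁⟩ := hC (k + 1)
  obtain ⟨hi0, -⟩ := integrable_norm_pow_of_tendsto h hC₀
  obtain ⟨hi1, hb1⟩ := integrable_norm_pow_of_tendsto h hC₁
  rw [Metric.tendsto_atTop']
  intro ε hε
  obtain ⟨T, hT, hTε⟩ : ∃ T : ℝ, 0 < T ∧ C₁ / T < ε / 3 := by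
    have : Tendsto (fun T : ℝ => C₁ / T) atTop (𝓝 0) := tendsto_const_nhds.div_atTop tendsto_id
    exact ((eventually_gt_atTop 0).and (this.eventually_lt_const (by positivity))).exists
  have h3 := (ProbabilityMeasure.tendsto_iff_forall_integral_rclike_tendsto ℂ).1 h
    (cutoffPow k T hT.le)
  have h4 := Metric.tendsto_nhds.1 h3 (ε / 3) (by positivity)
  obtain ⟨N, hN⟩ := eventually_atTop.1 (hC₀.and (hC₁.and h4))
  refine ⟨N, fun n hn => ?_⟩
  obtain ⟨a0, a1, a2⟩ := hN n hn.le
  have b1 := norm_analyticMoment_sub_cutoffPow_le hT a0.1 a1.1 a1.2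
  have b2 := norm_analyticMoment_sub_cutoffPow_le hT hi0 hi1 hb1
  rw [dist_eq_norm] at a2 ⊢
  set A := analyticMoment (μ n : Measure ℂ) k
  set B := analyticMoment (ν : Measure ℂ) k
  set P := ∫ z, cutoffPow k T hT.le z ∂(μ n : Measure ℂ)
  set Q := ∫ z, cutoffPow k T hT.le z ∂(ν : Measure ℂ)
  calc ‖A - B‖ = ‖(A - P) + (P - Q) + -(B - Q)‖ := by congr 1; ring
    _ ≤ ‖A - P‖ + ‖P - Q‖ + ‖-(B - Q)‖ := norm_add₃_le
    _ < ε := by rw [norm_neg]; linarith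

/-- Markov's inequality at radius `2R` with the `k`-th moment bounds the mass by `C 2^(-k)`, for
every `k`. -/
theorem measure_compl_closedBall_eq_zero {ν : Measure ℂ} [IsFiniteMeasure ν] {C R : ℝ} (hR : 0 < R)
    (h : ∀ k, Integrable (fun z : ℂ => ‖z‖ ^ k) ν ∧ ∫ z, ‖z‖ ^ k ∂ν ≤ C * R ^ k) :
    ν (Metric.closedBall 0 (2 * R))ᶜ = 0 := by
  have hset : (Metric.closedBall (0 : ℂ) (2 * R))ᶜ = {z | 2 * R < ‖z‖} := by
    ext z; simp
  rw [hset]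
  have h1 : ∀ k : ℕ, ν {z | 2 * R < ‖z‖} ≤ ENNReal.ofReal (C * (1 / 2) ^ k) := by
    intro k
    convert measure_norm_gt_le (by positivity : 0 < 2 * R) (h k).1 (h k).2 using 2
    rw [eq_div_iff (by positivity), mul_assoc, ← mul_pow]
    congr 2
    ring
  have h2 : Tendsto (fun k : ℕ => ENNReal.ofReal (C * (1 / 2) ^ k)) atTop (𝓝 0) := by
    have := (tendsto_pow_atTop_nhds_zero_of_lt_one (r := (1 / 2 : ℝ)) (by norm_num)
      (by norm_num)).const_mul C
    rw [mul_zero] at this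
    simpa using ENNReal.tendsto_ofReal this
  exact le_antisymm (ge_of_tendsto' h2 h1) zero_le

/-! ### Determinacy by analytic moments and the method of moments. -/

/-- A closed subset of `ℂ` on which measures are determined by their analytic moments, because
mixed and absolute moments reduce to analytic ones. -/
structure IsMomentRigid (S : Set ℂ) : Prop where
  isClosed : IsClosed S
  mixed : ∀ j k : ℕ, ∃ l : ℕ, (∀ z ∈ S, z ^ j * (starRingEnd ℂ z) ^ k = z ^ l) ∨
    (∀ z ∈ S, z ^ j * (starRingEnd ℂ z) ^ k = starRingEnd ℂ (z ^ l))
  absolute : ∀ k : ℕ, ∃ l ≤ k, ∀ z ∈ S, ‖z‖ ^ k = (z ^ l).re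

theorem IsMomentRigid.integral_mixed_eq {S : Set ℂ} (hS : IsMomentRigid S) {μ ν : Measure ℂ}
    (hμ : ∀ᵐ z ∂μ, z ∈ S) (hν : ∀ᵐ z ∂ν, z ∈ S)
    (h : ∀ k, analyticMoment μ k = analyticMoment ν k) (j k : ℕ) :
    ∫ z, z ^ j * (starRingEnd ℂ z) ^ k ∂μ = ∫ z, z ^ j * (starRingEnd ℂ z) ^ k ∂ν := by
  obtain ⟨l, hl | hl⟩ := hS.mixed j k
  · rw [integral_congr_ae (hμ.mono hl), integral_congr_ae (hν.mono hl)]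
    exact h l
  · rw [integral_congr_ae (hμ.mono hl), integral_congr_ae (hν.mono hl), integral_conj,
      integral_conj]
    exact congrArg _ (h l)

/-- Finite measures on a compact set with the same mixed moments are equal. -/
theorem measure_ext_of_mixed_moments {μ ν : Measure ℂ} [IsFiniteMeasure μ] [IsFiniteMeasure ν]
    {K : Set ℂ} (hK : IsCompact K) (hμ : ∀ᵐ z ∂μ, z ∈ K) (hν : ∀ᵐ z ∂ν, z ∈ K)
    (h : ∀ j k : ℕ,
      ∫ z, z ^ j * (starRingEnd ℂ z) ^ k ∂μ = ∫ z, z ^ j * (starRingEnd ℂ z) ^ k ∂ν) :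
    μ = ν := by
  have hKm : MeasurableSet K := hK.measurableSet
  have : CompactSpace K := isCompact_iff_compactSpace.1 hK
  have hrestr : ∀ ρ : Measure ℂ, (∀ᵐ z ∂ρ, z ∈ K) → ∀ f : ℂ → ℂ,
      ∫ x : K, f x ∂(ρ.comap Subtype.val) = ∫ z, f z ∂ρ := by
    intro ρ hρ f
    rw [integral_subtype_comap hKm f, Measure.restrict_eq_self_of_ae_mem hρ]
  have hfin : ∀ ρ : Measure ℂ, IsFiniteMeasure ρ →
      IsFiniteMeasure (ρ.comap (Subtype.val : K → ℂ)) := fun ρ hρ =>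
    ⟨(Measure.comap_apply_le (Subtype.val : K → ℂ) ρ
      MeasurableSet.univ.nullMeasurableSet).trans_lt (measure_lt_top _ _)⟩
  have := hfin μ inferInstance
  have := hfin ν inferInstance
  have hint : ∀ (ρ : Measure K) [IsFiniteMeasure ρ] (f : C(K, ℂ)), Integrable f ρ := fun ρ _ f =>
    (BoundedContinuousFunction.mkOfCompact f).integrable ρ
  let κ : Measure K := μ.comap Subtype.val
  let κ' : Measure K := ν.comap Subtype.val
  -- The continuous functions on which the two measures agree form a closed subspace. It contains
  -- all `z^j conj(z)^k`, so by Stone–Weierstrass it is everything.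
  let V : Submodule ℂ C(K, ℂ) :=
    { carrier := {f | ∫ x, f x ∂κ = ∫ x, f x ∂κ'}
      add_mem' := fun {f g} hf hg => by
        change ∫ x, f x + g x ∂κ = ∫ x, f x + g x ∂κ'
        rw [integral_add (hint κ f) (hint κ g), integral_add (hint κ' f) (hint κ' g)]
        exact congrArg₂ _ hf hg
      zero_mem' := by simp
      smul_mem' := fun a f hf => by
        change ∫ x, a • f x ∂κ = ∫ x, a • f x ∂κ'
        rw [integral_smul, integral_smul]
        exact congrArg _ hf }
  have hVclosed : IsClosed (V : Set C(K, ℂ)) := by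
    have hcont : ∀ (ρ : Measure K) [IsFiniteMeasure ρ],
        Continuous fun f : C(K, ℂ) => ∫ x, f x ∂ρ := by
      intro ρ _
      refine (LipschitzWith.of_dist_le_mul (K := ⟨ρ.real Set.univ, measureReal_nonneg⟩)
        fun f g => ?_).continuous
      rw [dist_eq_norm, ← integral_sub (hint ρ f) (hint ρ g), mul_comm]
      refine norm_integral_le_of_norm_le_const (Eventually.of_forall fun x => ?_)
      rw [← dist_eq_norm]
      exact ContinuousMap.dist_apply_le_dist x
    exact isClosed_eq (hcont κ) (hcont κ')
  have hVtop : ∀ f : C(K, ℂ), f ∈ V := by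
    intro f
    have hdense := polynomialFunctions.starClosure_topologicalClosure K (𝕜 := ℂ)
    have hf : f ∈ (polynomialFunctions K).starClosure.topologicalClosure := by
      rw [hdense]; trivial
    have hsub : ((polynomialFunctions K).starClosure : Set C(K, ℂ)) ⊆ V := by
      intro g hg
      rw [polynomialFunctions.starClosure_eq_adjoin_X, SetLike.mem_coe,
        ← StarSubalgebra.mem_toSubalgebra, StarAlgebra.adjoin_toSubalgebra,
        ← Subalgebra.mem_toSubmodule, Algebra.adjoin_eq_span] at hg
      refine Submodule.span_le.2 ?_ hg
      intro p hp
      rw [Set.star_singleton, Set.union_singleton, Set.pair_comm, SetLike.mem_coe,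
        Submonoid.mem_closure_pair] at hp
      obtain ⟨j, k, rfl⟩ := hp
      have := h j k
      rw [← hrestr μ hμ, ← hrestr ν hν] at this
      change ∫ x, _ ∂κ = ∫ x, _ ∂κ'
      convert this using 2 <;> simp
    exact hVclosed.closure_subset_iff.2 hsub hf
  refine ext_of_forall_integral_eq_of_IsFiniteMeasure fun f => ?_
  let g : C(K, ℂ) := ⟨fun x => ((f x : ℝ) : ℂ), by fun_prop⟩
  have hg : ∫ x : K, ((f x : ℝ) : ℂ) ∂κ = ∫ x : K, ((f x : ℝ) : ℂ) ∂κ' := hVtop g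
  rw [hrestr μ hμ (fun z => ((f z : ℝ) : ℂ)), hrestr ν hν (fun z => ((f z : ℝ) : ℂ)),
    integral_complex_ofReal, integral_complex_ofReal] at hg
  exact_mod_cast hg

theorem IsMomentRigid.measure_ext {S : Set ℂ} (hS : IsMomentRigid S) {μ ν : ProbabilityMeasure ℂ}
    (hμ : (μ : Measure ℂ) Sᶜ = 0) (hν : (ν : Measure ℂ) Sᶜ = 0)
    (hμK : ∃ K : Set ℂ, IsCompact K ∧ (μ : Measure ℂ) Kᶜ = 0)
    (hνK : ∃ K : Set ℂ, IsCompact K ∧ (ν : Measure ℂ) Kᶜ = 0)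
    (h : ∀ k, analyticMoment (μ : Measure ℂ) k = analyticMoment (ν : Measure ℂ) k) : μ = ν := by
  obtain ⟨K₁, hK₁, h₁⟩ := hμK
  obtain ⟨K₂, hK₂, h₂⟩ := hνK
  refine ProbabilityMeasure.toMeasure_injective (measure_ext_of_mixed_moments (hK₁.union hK₂) ?_ ?_ (hS.integral_mixed_eq hμ hν h))
  · exact measure_mono_null (Set.compl_subset_compl.2 Set.subset_union_left) h₁
  · exact measure_mono_null (Set.compl_subset_compl.2 Set.subset_union_right) h₂

theorem IsMomentRigid.integral_norm_pow {S : Set ℂ} (hS : IsMomentRigid S) (k : ℕ) :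
    ∃ l ≤ k, ∀ μ : Measure ℂ, μ Sᶜ = 0 → Integrable (fun z : ℂ => ‖z‖ ^ l) μ →
      ∫ z, ‖z‖ ^ k ∂μ = (analyticMoment μ l).re := by
  obtain ⟨l, hlk, hl⟩ := hS.absolute k
  refine ⟨l, hlk, fun μ hμ hi => ?_⟩
  rw [integral_congr_ae (Filter.Eventually.mono (show ∀ᵐ z ∂μ, z ∈ S from hμ) hl), analyticMoment]
  exact integral_re (integrable_pow_of_norm hi)

/-- The method of moments on a moment rigid set, for exponentially bounded limit moments. -/
theorem IsMomentRigid.exists_tendsto {S : Set ℂ} (hS : IsMomentRigid S)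
    {μ : ℕ → ProbabilityMeasure ℂ} {m : ℕ → ℂ}
    (hsupp : ∀ᶠ n in atTop, (μ n : Measure ℂ) Sᶜ = 0)
    (hint : ∀ᶠ n in atTop, ∀ k, Integrable (fun z : ℂ => ‖z‖ ^ k) (μ n : Measure ℂ))
    (hm : ∀ k, Tendsto (fun n => analyticMoment (μ n : Measure ℂ) k) atTop (𝓝 (m k)))
    {C R : ℝ} (hR : 0 < R) (hmb : ∀ k, ‖m k‖ ≤ C * R ^ k) :
    ∃ ν : ProbabilityMeasure ℂ, (ν : Measure ℂ) Sᶜ = 0 ∧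
      (∃ K : Set ℂ, IsCompact K ∧ (ν : Measure ℂ) Kᶜ = 0) ∧
      (∀ k, analyticMoment (ν : Measure ℂ) k = m k) ∧ Tendsto μ atTop (𝓝 ν) := by
  have hC0 : 0 ≤ C := by simpa using (norm_nonneg _).trans (hmb 0)
  have hbdd : ∀ k, ∃ B : ℝ, ∀ᶠ n in atTop, Integrable (fun z : ℂ => ‖z‖ ^ k) (μ n : Measure ℂ) ∧
      ∫ z, ‖z‖ ^ k ∂(μ n : Measure ℂ) ≤ B := by
    intro k
    obtain ⟨l, -, hl⟩ := hS.integral_norm_pow k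
    refine ⟨‖m l‖ + 1, ?_⟩
    filter_upwards [hsupp, hint, (hm l).norm.eventually_le_const (lt_add_one _)] with n h1 h2 h3
    refine ⟨h2 k, ?_⟩
    rw [hl _ h1 (h2 l)]
    exact (Complex.re_le_norm _).trans h3
  -- Prokhorov's theorem, with tightness from Markov's inequality for the first absolute moment.
  have hcompact : IsCompact (closure (Set.range μ)) := by
    refine isCompact_closure_of_isTightMeasureSet ?_
    have hset : {((ρ : ProbabilityMeasure ℂ) : Measure ℂ) | ρ ∈ Set.range μ} =
        Set.range fun n => (μ n : Measure ℂ) := by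
      ext ρ; simp
    rw [hset]
    refine isTightMeasureSet_range_of_tendsto_limsup_measure_norm_gt ?_
    obtain ⟨B, hB⟩ := hbdd 1
    have h0 : Tendsto (fun r : ℝ => ENNReal.ofReal (B / r ^ 1)) atTop (𝓝 0) := by
      have : Tendsto (fun r : ℝ => B / r ^ 1) atTop (𝓝 0) := by
        simpa using tendsto_const_nhds.div_atTop tendsto_id
      simpa using ENNReal.tendsto_ofReal this
    refine tendsto_of_tendsto_of_tendsto_of_le_of_le' tendsto_const_nhds h0
      (Eventually.of_forall fun _ => zero_le) ?_
    filter_upwards [eventually_gt_atTop 0] with r hr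
    refine limsup_le_of_le ⟨0, by simp⟩ ?_
    filter_upwards [hB] with n hn
    exact measure_norm_gt_le hr hn.1 hn.2
  -- Every cluster point has moments `m`, lives on `S` and has compact support, so by rigidity there
  -- is only one; compactness then turns it into the limit.
  have hcluster : ∀ ν : ProbabilityMeasure ℂ, MapClusterPt ν atTop μ →
      (ν : Measure ℂ) Sᶜ = 0 ∧ (∃ K : Set ℂ, IsCompact K ∧ (ν : Measure ℂ) Kᶜ = 0) ∧
      ∀ k, analyticMoment (ν : Measure ℂ) k = m k := by
    intro ν hν
    obtain ⟨φ, hφ, hlim⟩ := hν.tendsto_subseq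
    have hφ' := hφ.tendsto_atTop
    have hmom : ∀ k, analyticMoment (ν : Measure ℂ) k = m k := fun k =>
      tendsto_nhds_unique (tendsto_analyticMoment hlim (fun k => by
        obtain ⟨B, hB⟩ := hbdd k
        exact ⟨B, hφ'.eventually hB⟩) k) ((hm k).comp hφ')
    have hνS : (ν : Measure ℂ) Sᶜ = 0 := by
      have h1 := ProbabilityMeasure.le_liminf_measure_open_of_tendsto hlim hS.isClosed.isOpen_compl
      refine le_antisymm (h1.trans ?_) zero_le
      refine liminf_le_of_frequently_le' (Eventually.frequently ?_)
      filter_upwards [hφ'.eventually hsupp] with n hn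
      exact hn.le
    have hνi : ∀ k, Integrable (fun z : ℂ => ‖z‖ ^ k) (ν : Measure ℂ) := fun k => by
      obtain ⟨B, hB⟩ := hbdd k
      exact (integrable_norm_pow_of_tendsto hlim (hφ'.eventually hB)).1
    refine ⟨hνS, ⟨_, isCompact_closedBall (0 : ℂ) (2 * max R 1),
      measure_compl_closedBall_eq_zero (C := C) (by positivity) fun k => ⟨hνi k, ?_⟩⟩, hmom⟩
    obtain ⟨l, hlk, hl⟩ := hS.integral_norm_pow k
    rw [hl _ hνS (hνi l), hmom]
    calc (m l).re ≤ ‖m l‖ := Complex.re_le_norm _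
      _ ≤ C * R ^ l := hmb l
      -- The exponent `l` may be smaller than `k`, so the base is raised to at least `1` before
      -- replacing `l` by `k`.
      _ ≤ C * max R 1 ^ l := by gcongr; exact le_max_left _ _
      _ ≤ C * max R 1 ^ k := by gcongr; exact le_max_right _ _
  have hmem : ∀ᶠ n in atTop, μ n ∈ closure (Set.range μ) :=
    Eventually.of_forall fun n => subset_closure ⟨n, rfl⟩
  obtain ⟨ν, -, hν⟩ := hcompact.exists_mapClusterPt_of_frequently hmem.frequently
  obtain ⟨h1, h2, h3⟩ := hcluster ν hν
  refine ⟨ν, h1, h2, h3, hcompact.tendsto_nhds_of_unique_mapClusterPt hmem fun ν' _ hν' => ?_⟩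
  obtain ⟨h1', h2', h3'⟩ := hcluster ν' hν'
  exact hS.measure_ext h1' h1 h2' h2 fun k => by rw [h3, h3']

theorem isMomentRigid_nonneg : IsMomentRigid (Complex.ofReal '' Set.Ici (0 : ℝ)) where
  isClosed := Complex.isometry_ofReal.isClosedEmbedding.isClosedMap _ isClosed_Ici
  mixed j k := by
    refine ⟨j + k, Or.inl ?_⟩
    rintro _ ⟨r, -, rfl⟩
    rw [Complex.conj_ofReal, pow_add]
  absolute k := by
    refine ⟨k, le_rfl, ?_⟩
    rintro _ ⟨r, hr, rfl⟩
    rw [Complex.norm_real, Real.norm_of_nonneg hr, ← Complex.ofReal_pow, Complex.ofReal_re]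

theorem isMomentRigid_sphere : IsMomentRigid (Metric.sphere (0 : ℂ) 1) where
  isClosed := Metric.isClosed_sphere
  mixed j k := by
    have hz : ∀ z ∈ Metric.sphere (0 : ℂ) 1, z * starRingEnd ℂ z = 1 := by
      intro z hz
      rw [Complex.mul_conj, Complex.normSq_eq_norm_sq, mem_sphere_zero_iff_norm.1 hz]
      simp
    rcases le_total k j with h | h
    · refine ⟨j - k, Or.inl fun z hzS => ?_⟩
      obtain ⟨d, rfl⟩ := Nat.exists_eq_add_of_le h
      rw [pow_add, Nat.add_sub_cancel_left, mul_right_comm, ← mul_pow, hz z hzS, one_pow, one_mul]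
    · refine ⟨k - j, Or.inr fun z hzS => ?_⟩
      obtain ⟨d, rfl⟩ := Nat.exists_eq_add_of_le h
      rw [pow_add, Nat.add_sub_cancel_left, ← mul_assoc, ← mul_pow, hz z hzS, one_pow, one_mul,
        map_pow]
  absolute k := ⟨0, Nat.zero_le k, fun z hz => by simp [mem_sphere_zero_iff_norm.1 hz]⟩

/-! ### The limit distribution -/

/-- Near `0` the moments sum to `1 + ψ`, and `ψ/(1+ψ) · exp(γ/(α+ψ)) = t` is the S-transform
identity rearranged. -/
theorem hasSTransform_of_analyticMoment {μ : Measure ℂ} {α γ : ℂ} (hα : α ≠ 0) {ψ : ℂ → ℂ}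
    (hψ : AnalyticAt ℂ ψ 0) (hψ0 : ψ 0 = 0) (hinv : ∀ᶠ t in 𝓝 0, limitInverse α γ (ψ t) = t)
    (hcomp : seriesComp (taylorSeries ψ) (taylorSeries (limitInverse α γ)) = PowerSeries.X)
    (hK : ∃ K : Set ℂ, IsCompact K ∧ μ Kᶜ = 0)
    (hm : ∀ k, analyticMoment μ k = PowerSeries.coeff k (1 + taylorSeries ψ)) :
    HasSTransform μ fun y => Complex.exp (γ / (α + y)) := by
  refine ⟨hK, ?_, analyticAt_exp_div hα γ, ?_⟩
  · have h0 : PowerSeries.constantCoeff (taylorSeries (limitInverse α γ)) = 0 := by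
      simp [constantCoeff_taylorSeries, limitInverse]
    -- The linear coefficient of `ψ ∘ χ = X` factors as the first moment times the linear
    -- coefficient of `χ`, so the first moment cannot vanish.
    have h1 := congrArg (PowerSeries.coeff 1) hcomp
    rw [coeff_seriesComp h0, Finset.sum_range_succ, Finset.sum_range_one] at h1
    simp only [pow_zero, pow_one, PowerSeries.coeff_one_X, PowerSeries.coeff_one] at h1
    rw [hm]
    intro h2
    simp only [map_add, PowerSeries.coeff_one, one_ne_zero, if_false, zero_add] at h1 h2
    rw [h2] at h1
    simp at h1
  · have hpsi : ∀ᶠ t in 𝓝 (0 : ℂ), psiTransform μ t = ψ t := by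
      have h1 : AnalyticAt ℂ (fun y => 1 + ψ y) 0 := analyticAt_const.add hψ
      have h2 : taylorSeries (fun y => 1 + ψ y) = 1 + taylorSeries ψ := by
        rw [taylorSeries_add analyticAt_const hψ, taylorSeries_const, map_one]
      filter_upwards [h1.eventually_hasSum_taylorSeries] with t ht
      rw [h2] at ht
      rw [psiTransform, momentSeries]
      simp only [hm]
      rw [ht.tsum_eq]
      ring
    have hne : ∀ᶠ t in 𝓝 (0 : ℂ), 1 + ψ t ≠ 0 := by
      have : ContinuousAt (fun t => 1 + ψ t) 0 := continuousAt_const.add hψ.continuousAt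
      exact this.eventually_ne (by simp [hψ0])
    filter_upwards [hpsi.filter_mono nhdsWithin_le_nhds, hne.filter_mono nhdsWithin_le_nhds,
      hinv.filter_mono nhdsWithin_le_nhds, self_mem_nhdsWithin] with t h1 h2 h3 h4
    have h5 : ψ t ≠ 0 := by
      intro h
      rw [h] at h3
      exact h4 (by simpa [limitInverse] using h3.symm)
    rw [h1]
    rw [limitInverse] at h3
    have h6 : (1 + ψ t) / ψ t * t =
        (1 + ψ t) / ψ t * (ψ t / (1 + ψ t) * Complex.exp (γ / (α + ψ t))) := by rw [h3]
    rw [h6]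
    field_simp

/-- For given limits `β` and `γ`, the zero distributions of all admissible sequences of
multiplicative Laguerre polynomials with zeros in a moment rigid set have the same weak limit. -/
theorem exists_limit_zeroDistribution {S : Set ℂ} (hS : IsMomentRigid S) {β : ℂ} {γ : ℝ}
    (hβ : β + 1 ≠ 0) :
    ∃ ν : ProbabilityMeasure ℂ, ∀ (b : ℕ → ℂ) (c : ℕ → ℕ),
      Tendsto (fun n : ℕ => b n / (n : ℂ)) atTop (𝓝 β) →
      Tendsto (fun n : ℕ => (c n : ℝ) / (n : ℝ)) atTop (𝓝 γ) →
      (∀ n : ℕ, 1 ≤ n → (n : ℂ) + b n ≠ 0) →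
      (∀ n : ℕ, 1 ≤ n → ∀ z ∈ (multiplicativeLaguerre n (b n) (c n)).roots, z ∈ S) →
      (ν : Measure ℂ) Sᶜ = 0 ∧
      Tendsto (fun n : ℕ => zeroDistribution (multiplicativeLaguerre n (b n) (c n)))
        atTop (𝓝 ν) ∧
      HasSTransform (ν : Measure ℂ) fun y : ℂ => Complex.exp ((γ : ℂ) / (β + 1 + y)) := by
  obtain ⟨ψ, hψ, hψ0, hinv, hcomp⟩ := exists_localInverse hβ (γ : ℂ)
  have hψ1 : AnalyticAt ℂ (fun y => 1 + ψ y) 0 := analyticAt_const.add hψ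
  have hT : taylorSeries (fun y => 1 + ψ y) = 1 + taylorSeries ψ := by
    rw [taylorSeries_add analyticAt_const hψ, taylorSeries_const, map_one]
  obtain ⟨C, R, hR, hCR⟩ := hψ1.norm_coeff_taylorSeries_le
  rw [hT] at hCR
  have key : ∀ (b : ℕ → ℂ) (c : ℕ → ℕ),
      Tendsto (fun n : ℕ => b n / (n : ℂ)) atTop (𝓝 β) →
      Tendsto (fun n : ℕ => (c n : ℝ) / (n : ℝ)) atTop (𝓝 γ) →
      (∀ n : ℕ, 1 ≤ n → (n : ℂ) + b n ≠ 0) →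
      (∀ n : ℕ, 1 ≤ n → ∀ z ∈ (multiplicativeLaguerre n (b n) (c n)).roots, z ∈ S) →
      ∃ ν : ProbabilityMeasure ℂ, (ν : Measure ℂ) Sᶜ = 0 ∧
        (∃ K : Set ℂ, IsCompact K ∧ (ν : Measure ℂ) Kᶜ = 0) ∧
        (∀ k, analyticMoment (ν : Measure ℂ) k = PowerSeries.coeff k (1 + taylorSeries ψ)) ∧
        Tendsto (fun n : ℕ => zeroDistribution (multiplicativeLaguerre n (b n) (c n)))
          atTop (𝓝 ν) := by
    intro b c hb hc hne hroots
    have hdeg : ∀ n : ℕ, 1 ≤ n → (multiplicativeLaguerre n (b n) (c n)).natDegree ≠ 0 := by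
      intro n hn
      rw [natDegree_multiplicativeLaguerre (hne n hn)]
      omega
    obtain ⟨n₀, T, hscheme⟩ := isMomentScheme_laguerre hβ hne hb hc
    have hcC : Tendsto (fun n => (c n : ℂ) / n) atTop (𝓝 (γ : ℂ)) := by
      exact ((Complex.continuous_ofReal.tendsto γ).comp hc).congr fun n => by simp
    have hlim := hscheme.coeffTendsto hβ (hb.add_const 1) hcC hcomp
    refine hS.exists_tendsto ?_ ?_ (fun k => ?_) hR hCR
    · filter_upwards [eventually_ge_atTop 1] with n hn
      exact zeroDistribution_compl_eq_zero (hdeg n hn) hS.isClosed.measurableSet (hroots n hn)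
    · filter_upwards [eventually_ge_atTop 1] with n hn k
      exact integrable_zeroDistribution (hdeg n hn) _
    · rcases eq_or_ne k 0 with rfl | hk
      · have : PowerSeries.coeff 0 (1 + taylorSeries ψ) = 1 := by
          simp [constantCoeff_taylorSeries, hψ0]
        rw [this]
        simp [analyticMoment]
      · have e : PowerSeries.coeff k (1 + taylorSeries ψ) =
            PowerSeries.coeff k (taylorSeries ψ) := by
          simp [PowerSeries.coeff_one, hk]
        rw [e]
        refine (hlim k).congr' ?_
        filter_upwards [eventually_ge_atTop 1] with n hn
        exact (analyticMoment_laguerre (hne n hn) (by omega) (c n) hk).symm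
  by_cases hex : ∃ (b : ℕ → ℂ) (c : ℕ → ℕ),
      Tendsto (fun n : ℕ => b n / (n : ℂ)) atTop (𝓝 β) ∧
      Tendsto (fun n : ℕ => (c n : ℝ) / (n : ℝ)) atTop (𝓝 γ) ∧
      (∀ n : ℕ, 1 ≤ n → (n : ℂ) + b n ≠ 0) ∧
      (∀ n : ℕ, 1 ≤ n → ∀ z ∈ (multiplicativeLaguerre n (b n) (c n)).roots, z ∈ S)
  · obtain ⟨b₀, c₀, h1, h2, h3, h4⟩ := hex
    obtain ⟨ν, hνS, hνK, hνm, -⟩ := key b₀ c₀ h1 h2 h3 h4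
    refine ⟨ν, fun b c hb hc hne hroots => ?_⟩
    obtain ⟨ν', hνS', hνK', hνm', hlim⟩ := key b c hb hc hne hroots
    have : ν' = ν := hS.measure_ext hνS' hνS hνK' hνK fun k => by rw [hνm, hνm']
    rw [this] at hlim
    exact ⟨hνS, hlim, hasSTransform_of_analyticMoment hβ hψ hψ0 hinv hcomp hνK hνm⟩
  · exact ⟨⟨Measure.dirac 0, inferInstance⟩, fun b c hb hc hne hroots =>
      absurd ⟨b, c, hb, hc, hne, hroots⟩ hex⟩

/-! ### Assembly of the positive and unitary cases. -/

theorem re_eq_of_tendsto_unitary {β : ℂ} {b : ℕ → ℂ}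
    (hb : Tendsto (fun n : ℕ => b n / (n : ℂ)) atTop (𝓝 β))
    (h : ∀ n : ℕ, 1 ≤ n → (b n).re = -(n : ℝ) / 2) : β.re = -1 / 2 := by
  refine tendsto_nhds_unique ((Complex.continuous_re.tendsto β).comp hb) ?_
  refine tendsto_const_nhds.congr' ?_
  filter_upwards [eventually_ge_atTop 1] with n hn
  have hn' : (n : ℝ) ≠ 0 := by exact_mod_cast (by omega : n ≠ 0)
  simp only [Function.comp]
  rw [Complex.div_natCast_re, h n hn]
  field_simp

theorem mainTheorem2 :
    ∃ ν : ℂ → ℝ → ProbabilityMeasure ℂ,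
      ∀ (β : ℂ) (γ : ℝ), 0 < γ →
      ∀ (b : ℕ → ℂ) (c : ℕ → ℕ),
        Tendsto (fun n : ℕ => b n / (n : ℂ)) atTop (𝓝 β) →
        Tendsto (fun n : ℕ => (c n : ℝ) / (n : ℝ)) atTop (𝓝 γ) →
        -- the positive case
        ((∀ n : ℕ, 1 ≤ n → ∃ x : ℝ, b n = (x : ℂ) ∧ x ∉ Set.Icc (-(n : ℝ)) 0) →
          (∃ x : ℝ, β = (x : ℂ) ∧ x ∉ Set.Icc (-1 : ℝ) 0) →
          (ν β γ : Measure ℂ) (Complex.ofReal '' Set.Ici (0 : ℝ))ᶜ = 0 ∧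
          Tendsto (fun n : ℕ => zeroDistribution (multiplicativeLaguerre n (b n) (c n)))
            atTop (𝓝 (ν β γ)) ∧
          HasSTransform (ν β γ : Measure ℂ)
            (fun y : ℂ => Complex.exp ((γ : ℂ) / (β + 1 + y)))) ∧
        -- the unitary case
        ((∀ n : ℕ, 1 ≤ n → (b n).re = -(n : ℝ) / 2) →
          β.re = -1 / 2 ∧
          (ν β γ : Measure ℂ) (Metric.sphere (0 : ℂ) 1)ᶜ = 0 ∧
          Tendsto (fun n : ℕ => zeroDistribution (multiplicativeLaguerre n (b n) (c n)))
            atTop (𝓝 (ν β γ)) ∧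
          HasSTransform (ν β γ : Measure ℂ)
            (fun y : ℂ => Complex.exp ((γ : ℂ) / (β + 1 + y)))) := by
  have key : ∀ (β : ℂ) (γ : ℝ), ∃ ν : ProbabilityMeasure ℂ,
      ∀ (b : ℕ → ℂ) (c : ℕ → ℕ),
        Tendsto (fun n : ℕ => b n / (n : ℂ)) atTop (𝓝 β) →
        Tendsto (fun n : ℕ => (c n : ℝ) / (n : ℝ)) atTop (𝓝 γ) →
        ((∀ n : ℕ, 1 ≤ n → ∃ x : ℝ, b n = (x : ℂ) ∧ x ∉ Set.Icc (-(n : ℝ)) 0) →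
          (∃ x : ℝ, β = (x : ℂ) ∧ x ∉ Set.Icc (-1 : ℝ) 0) →
          (ν : Measure ℂ) (Complex.ofReal '' Set.Ici (0 : ℝ))ᶜ = 0 ∧
          Tendsto (fun n : ℕ => zeroDistribution (multiplicativeLaguerre n (b n) (c n)))
            atTop (𝓝 ν) ∧
          HasSTransform (ν : Measure ℂ)
            (fun y : ℂ => Complex.exp ((γ : ℂ) / (β + 1 + y)))) ∧
        ((∀ n : ℕ, 1 ≤ n → (b n).re = -(n : ℝ) / 2) →
          (ν : Measure ℂ) (Metric.sphere (0 : ℂ) 1)ᶜ = 0 ∧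
          Tendsto (fun n : ℕ => zeroDistribution (multiplicativeLaguerre n (b n) (c n)))
            atTop (𝓝 ν) ∧
          HasSTransform (ν : Measure ℂ)
            (fun y : ℂ => Complex.exp ((γ : ℂ) / (β + 1 + y)))) := by
    intro β γ
    -- A single measure must serve both cases for each `(β, γ)`. There is no conflict: the unitary
    -- case forces `Re β = -1/2`, which lies in the interval `[-1, 0]` excluded in the positive
    -- case.
    by_cases hβ : ∃ x : ℝ, β = (x : ℂ) ∧ x ∉ Set.Icc (-1 : ℝ) 0
    · obtain ⟨x, rfl, hx⟩ := hβ
      have hx1 : (x : ℂ) + 1 ≠ 0 := by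
        rw [add_comm]
        simpa using natCast_add_ofReal_ne_zero (n := 1) (by simpa using hx)
      obtain ⟨ν, hν⟩ := exists_limit_zeroDistribution isMomentRigid_nonneg (γ := γ) hx1
      refine ⟨ν, fun b c hb hc => ⟨fun hpos _ => ?_, fun hunit => ?_⟩⟩
      · refine hν b c hb hc (fun n hn => ?_) fun n hn z hz => ?_
        · obtain ⟨y, hy, hy'⟩ := hpos n hn
          rw [hy]
          exact natCast_add_ofReal_ne_zero hy'
        · obtain ⟨y, hy, hy'⟩ := hpos n hn
          rw [hy] at hz
          obtain ⟨r, hr, rfl⟩ := multiplicativeLaguerre_roots_pos hn hy' (c n) z hz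
          exact ⟨r, hr.le, rfl⟩
      · have := re_eq_of_tendsto_unitary hb hunit
        rw [Complex.ofReal_re] at this
        exact absurd (by rw [this]; constructor <;> norm_num) hx
    · by_cases hre : β.re = -1 / 2
      · have h1 : β + 1 ≠ 0 := by
          intro h
          have := congrArg Complex.re h
          rw [Complex.add_re, hre, Complex.one_re, Complex.zero_re] at this
          norm_num at this
        obtain ⟨ν, hν⟩ := exists_limit_zeroDistribution isMomentRigid_sphere (γ := γ) h1
        refine ⟨ν, fun b c hb hc => ⟨fun _ h => absurd h hβ, fun hunit => ?_⟩⟩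
        refine hν b c hb hc (fun n hn h => ?_) fun n hn =>
          multiplicativeLaguerre_roots_norm hn (hunit n hn) (c n)
        have hn' : (0 : ℝ) < n := by exact_mod_cast hn
        have := congrArg Complex.re h
        rw [Complex.add_re, hunit n hn, Complex.natCast_re, Complex.zero_re] at this
        linarith
      · exact ⟨⟨Measure.dirac 0, inferInstance⟩, fun b c hb _ =>
          ⟨fun _ h => absurd h hβ, fun hunit => absurd (re_eq_of_tendsto_unitary hb hunit) hre⟩⟩
  choose ν hν using key
  refine ⟨ν, fun β γ _ b c hb hc => ?_⟩
  obtain ⟨h1, h2⟩ := hν β γ b c hb hc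
  exact ⟨h1, fun hunit => ⟨re_eq_of_tendsto_unitary hb hunit, h2 hunit⟩⟩
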